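/- Setting. Let $\mathcal X$ be a measurable space with a topology, $\rho$ a probability measure on $\mathcal X\times\{-1,1\}$ with marginal $\rho_{\mathcal X}$ and conditional probability $\rho(1|x)$, and $\mathcal H_k$ the reproducing kernel Hilbert space of a measurable real-valued kernel $k$ on $\mathcal X$. Let $\phi:\mathbb R\to[0,\infty)$ be convex, $l(\zeta,y)=\phi(y\zeta)$, $\mathcal L(g)=\mathbb E[l(g(X),Y)]$, $\mathcal L_\lambda(g)=\mathcal L(g)+\frac\lambda2\|g\|_{\mathcal H_k}^2$, and let $\mathcal R(g)=\mathbb P[\mathrm{sgn}(g(X))\ne Y]$ be the expected classification error, where $(X,Y)\sim\rho$ and $\mathrm{sgn}(0)=0$. Put $h_*(\mu)=\arg\min_{h\in\mathbb R}\{\mu\phi(h)+(1-\mu)\phi(-h)\}$ and $l_*(\mu)=\min_{h\in\mathbb R}\{\mu\phi(h)+(1-\mu)\phi(-h)\}$ for $\mu\in(0,1)$, $d_{l_*}(\eta_1,\eta_2)=-l_*(\eta_2)+l_*(\eta_1)+l_*'(\eta_1)(\eta_2-\eta_1)$, and $m(\delta)=\max\{h_*(\tfrac12+\delta),|h_*(\tfrac12-\delta)|\}$.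 Assumptions. (A1) $\phi$ is differentiable; there is $M>0$ with $|\partial_\zeta l(\zeta,y)|\le M$ for all $\zeta,y$; there is $L>0$ with $|\mathcal L(g+h)-\mathcal L(g)-\langle\nabla\mathcal L(g),h\rangle_{\mathcal H_k}|\le\frac L2\|h\|_{\mathcal H_k}^2$ for all $g,h\in\mathcal H_k$. (A2) $\mathrm{supp}(\rho_{\mathcal X})=\mathcal X$, and there is $R>0$ with $k(x,x)\le R^2$ for all $x$. (A3) There is $\delta\in(0,\tfrac12)$ with $|\rho(1|X)-\tfrac12|>\delta$ $\rho_{\mathcal X}$-almost surely. (A4) $\rho(1|X)\in(0,1)$ $\rho_{\mathcal X}$-almost surely; on $(0,1)$ the function $h_*$ is well defined (the minimizer exists and is unique), differentiable, monotonically increasing and injective, and $\mathrm{sgn}(\mu-\tfrac12)=\mathrm{sgn}(h_*(\mu))$. (A5) For $\eta_1,\eta_2\in(0,1)$, $d_{l_*}(\eta_1,\eta_2)=0$ if and only if $\eta_1=\eta_2$; and $\mathcal H_k$ contains a minimizer of $\mathcal L$ over all measurable functions, which is unique up to $\rho_{\mathcal X}$-null sets. Theorem. Under (A1)–(A5) there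 is $\lambda_0>0$ such that for every $\lambda\in(0,\lambda_0]$ the functional $\mathcal L_\lambda$ has a minimizer $g_\lambda$ in $\mathcal H_k$ and the following holds. Let $\gamma>0$ and $\eta_t=\frac{2}{\lambda(\gamma+t)}$ with $\eta_1\le\min\{\frac1{L+\lambda},\frac1{2\lambda}\}$; let $\sigma>0$ be such that the variance of the stochastic gradient, $\mathbb E\|\partial_\zeta l(g(X),Y)k(X,\cdot)-\nabla\mathcal L(g)\|_{\mathcal H_k}^2$, is at most $\sigma^2$ for every $g\in\mathcal H_k$; let $g_1\in\mathcal H_k$ with $\|g_1\|_{\mathcal H_k}\le(2\eta_1+\frac1\lambda)MR$; and let $(x_t,y_t)_{t\ge1}$ be independent samples from $\rho$. Define the iterates of stochastic gradient descent by $$g_{t+1}=g_t-\eta_t\bigl(\partial_\zeta l(g_t(x_t),y_t)\,k(x_t,\cdot)+\lambda g_t\bigr),$$ and put $$\nu=\max\Bigl\{\tfrac{2}{\lambda^2}(L+\lambda)\sigma^2,\ (1+\gamma)\bigl(\mathcal L_\lambda(g_1)-\mathcal L_\lambda(g_\lambda)\bigr)\Bigr\}.$$ Then for every integer $T\ge0$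 with $T\ge\frac{32R^2\nu}{m(\delta)^2\lambda}-\gamma$, $$\mathbb E\bigl[\mathcal R(g_{T+1})-\mathcal R(\mathbb E[Y|x])\bigr]\le 2\exp\Bigl(-\frac{m(\delta)^2\lambda^2(\gamma+T)}{2^9\cdot 9\,M^2R^4}\Bigr),$$ where $\mathbb E[Y|x]=2\rho(1|x)-1$ is the Bayes classifier. -/

import Mathlib

open MeasureTheory ProbabilityTheory Set
open scoped InnerProductSpace

/-! Labels are elements of `ℤˣ = {-1, 1}`. -/

instance instMeasurableSingletonClassIntUnits : MeasurableSingletonClass ℤˣ :=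
  ⟨fun y => ⟨{(y : ℤ)}, measurableSet_singleton _, by
    ext u; simp [Units.ext_iff]⟩⟩

namespace KernelSGD

noncomputable section

/-! ### Real-valued notions attached to `φ : ℝ → ℝ` -/

/-- A label as a real number. -/
def lab (y : ℤˣ) : ℝ := ((y : ℤ) : ℝ)

/-- The loss `l(ζ, y) = φ(y ζ)`. -/
def loss (φ : ℝ → ℝ) (ζ : ℝ) (y : ℤˣ) : ℝ := φ (lab y * ζ)

/-- The partial derivative `∂_ζ l(ζ, y)` in the first variable. -/
def lossDeriv (φ : ℝ → ℝ) (ζ : ℝ) (y : ℤˣ) : ℝ := deriv (fun u => loss φ u y) ζ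

/-- The conditional risk `μ φ(h) + (1 - μ) φ(-h)`. -/
def condRisk (φ : ℝ → ℝ) (μ h : ℝ) : ℝ := μ * φ h + (1 - μ) * φ (-h)

/-- `h` minimizes the conditional risk at `μ`. -/
def IsCondMin (φ : ℝ → ℝ) (μ h : ℝ) : Prop := ∀ h' : ℝ, condRisk φ μ h ≤ condRisk φ μ h'

/-- The link function `h_*` is well defined on `(0, 1)`: the minimizer exists and is unique. -/
def LinkWellDefined (φ : ℝ → ℝ) : Prop := ∀ μ ∈ Ioo (0 : ℝ) 1, ∃! h : ℝ, IsCondMin φ μ h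

/-- The link function `h_*(μ) = argmin_h (μ φ(h) + (1 - μ) φ(-h))`. -/
def link (φ : ℝ → ℝ) (μ : ℝ) : ℝ := Classical.epsilon (IsCondMin φ μ)

/-- `l_*(μ)`, the minimal value of the conditional risk. -/
def lStar (φ : ℝ → ℝ) (μ : ℝ) : ℝ := ⨅ h : ℝ, condRisk φ μ h

/-- The Bregman divergence of the concave function `l_*`. -/
def bregman (φ : ℝ → ℝ) (η₁ η₂ : ℝ) : ℝ :=
  -lStar φ η₂ + lStar φ η₁ + deriv (lStar φ) η₁ * (η₂ - η₁)

/-- `m(δ) = max {h_*(1/2 + δ), |h_*(1/2 - δ)|}`. -/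
def margin (φ : ℝ → ℝ) (δ : ℝ) : ℝ := max (link φ (1 / 2 + δ)) |link φ (1 / 2 - δ)|

/-! ### The classification problem -/

section Problem

variable {X : Type*} [MeasurableSpace X]

/-- The conditional probability `ρ(1 | x)` of the label `1` given `x`. -/
def condProb (ρ : Measure (X × ℤˣ)) [IsFiniteMeasure ρ] (x : X) : ℝ := (ρ.condKernel x).real {1}

/-- The Bayes classifier `𝔼[Y | x] = 2 ρ(1 | x) - 1`. -/
def bayesClassifier (ρ : Measure (X × ℤˣ)) [IsFiniteMeasure ρ] (x : X) : ℝ := 2 * condProb ρ x - 1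

open Classical in
/-- The 0-1 error function. -/
def zeroOne (a b : ℝ) : ℝ := if a = b then 0 else 1

/-- The expected classification error `𝓡(g) = 𝔼[I(sgn(g(X)), Y)]`, where `sgn 0 = 0`. -/
def classError (ρ : Measure (X × ℤˣ)) (g : X → ℝ) : ℝ :=
  ∫ z, zeroOne (Real.sign (g z.1)) (lab z.2) ∂ρ

/-- The expected risk `𝓛(g) = 𝔼[l(g(X), Y)]`. -/
def risk (φ : ℝ → ℝ) (ρ : Measure (X × ℤˣ)) (g : X → ℝ) : ℝ := ∫ z, loss φ (g z.1) z.2 ∂ρ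

/-- `g` has finite expected risk. -/
def FiniteRisk (φ : ℝ → ℝ) (ρ : Measure (X × ℤˣ)) (g : X → ℝ) : Prop :=
  Integrable (fun z : X × ℤˣ => loss φ (g z.1) z.2) ρ

/-- `g` minimizes the expected risk over all measurable functions. For nonnegative `φ`, a measurable
function that does not satisfy `FiniteRisk` has risk `+∞`, hence it is no competitor. -/
def IsBayesRule (φ : ℝ → ℝ) (ρ : Measure (X × ℤˣ)) (g : X → ℝ) : Prop :=
  Measurable g ∧ FiniteRisk φ ρ g ∧
    ∀ f : X → ℝ, Measurable f → FiniteRisk φ ρ f → risk φ ρ g ≤ risk φ ρ f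

end Problem

/-! ### The reproducing kernel Hilbert space and stochastic gradient descent -/

section SGD

variable {X : Type*} (H : Type*) [NormedAddCommGroup H] [InnerProductSpace ℝ H] [CompleteSpace H]
  [RKHS ℝ H X ℝ]

/-- The reproducing kernel `k(x, x')` of `H`. -/
def ker (x x' : X) : ℝ := RKHS.kernel H x x' 1

/-- The function `k(x, ·)` as an element of `H`. -/
def feature (x : X) : H := RKHS.kerFun H x 1

variable {H} [MeasurableSpace X]

/-- The expected risk as a functional on `H`. -/
def riskH (φ : ℝ → ℝ) (ρ : Measure (X × ℤˣ)) (g : H) : ℝ := risk φ ρ g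

/-- The regularized expected risk `𝓛_λ(g) = 𝓛(g) + (λ/2) ‖g‖²`. -/
def regRisk (φ : ℝ → ℝ) (ρ : Measure (X × ℤˣ)) (lam : ℝ) (g : H) : ℝ :=
  riskH φ ρ g + lam / 2 * ‖g‖ ^ 2

/-- The stochastic gradient `∂_ζ l(g(x), y) k(x, ·)` of `𝓛` at `g` for the sample `z = (x, y)`. -/
def stochGrad (φ : ℝ → ℝ) (g : H) (z : X × ℤˣ) : H := lossDeriv φ (g z.1) z.2 • feature H z.1

/-- The stochastic gradient `G_λ(g, z)` of `𝓛_λ`. -/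
def regStochGrad (φ : ℝ → ℝ) (lam : ℝ) (g : H) (z : X × ℤˣ) : H := stochGrad φ g z + lam • g

/-- The variance of the stochastic gradient of `𝓛` at `g` (whose mean is `∇𝓛(g)`). -/
def gradVariance (φ : ℝ → ℝ) (ρ : Measure (X × ℤˣ)) (g : H) : ℝ :=
  ∫ z, ‖stochGrad φ g z - gradient (riskH φ ρ) g‖ ^ 2 ∂ρ

/-- The learning rate `η_t = 2 / (λ (γ + t))`. -/
def stepSize (lam γ : ℝ) (t : ℕ) : ℝ := 2 / (lam * (γ + t))

/-- Stochastic gradient descent driven by the samples `z 1, z 2, …`: the value at `n` is the iterate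
`g_{n+1}`, so the value at `0` is the initial function `g₁`. -/
def sgd (φ : ℝ → ℝ) (lam γ : ℝ) (g₁ : H) (z : ℕ → X × ℤˣ) : ℕ → H
  | 0 => g₁
  | n + 1 => sgd φ lam γ g₁ z n -
      stepSize lam γ (n + 1) • regStochGrad φ lam (sgd φ lam γ g₁ z n) (z (n + 1))

/-- The constant `ν`; here `gl` stands for the minimizer `g_λ` of `𝓛_λ`. -/
def nu (φ : ℝ → ℝ) (ρ : Measure (X × ℤˣ)) (lam γ L σ : ℝ) (g₁ gl : H) : ℝ :=
  max (2 / lam ^ 2 * (L + lam) * σ ^ 2) ((1 + γ) * (regRisk φ ρ lam g₁ - regRisk φ ρ lam gl))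

end SGD

end

end KernelSGD

namespace KernelSGD

/-! ### Smooth convex functionals on a Hilbert space -/

section Convex

variable {H : Type*} [NormedAddCommGroup H] [InnerProductSpace ℝ H] {F : H → ℝ} {G : H → H} {L : ℝ}

/-! The exponential rate comes from a margin: a function of `H` that is close enough in norm to the
Bayes rule has no excess classification error at all, so the expected excess is at most the
probability that the iterate is far away.

Approximation. As `λ → 0+` the regularized minimizers `g_λ` converge in `H` to some `g₀` of minimal
risk (`exists_tendsto_regularized`). By uniqueness of the Bayes rule, `g₀(x) = h_*(ρ(1|x))` almost
surely (`ae_eq_link_of_isBayesRule`), and the noise condition gives `|g₀| ≥ m(δ)`. Since `|g(x) -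
g₀(x)| ≤ R‖g - g₀‖`, every `g` with `‖g - g₀‖ < m(δ)/R` has the Bayes sign almost surely
(`sign_eq_of_abs_sub_link_lt`). The threshold `λ₀` makes `‖g_λ - g₀‖ < m(δ)/(2R)`, which leaves a
ball of radius `m(δ)/(2R)` around `g_λ`.

Concentration. A noiseless gradient step contracts towards `g_λ` by the factor `1 - ηλ`, and the
noise is centred with norm at most `2MR`. Convexity of `s ↦ cosh √s` makes `E cosh(θ‖g_t - g_λ‖)`
propagate with a sub-Gaussian factor and no dimension dependence (`lintegral_cosh_step_le`).
Iterating and applying Markov's inequality gives the tail bound `measureReal_norm_sgd_sub_ge_le`.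
The lower bound on `T` makes the remaining influence of `g₁` at most half of the radius
(`initial_error_le`). This yields the exponent with `2^9` in the denominator; the factor `9` in the
statement is slack. -/

theorem norm_sub_sq_le_of_smooth (hL : 0 < L)
    (hconv : ∀ g h, F g + ⟪G g, h - g⟫_ℝ ≤ F h)
    (hsmooth : ∀ g h, F (g + h) - F g - ⟪G g, h⟫_ℝ ≤ L / 2 * ‖h‖ ^ 2) (g h : H) :
    ‖G g - G h‖ ^ 2 ≤ L * ⟪G g - G h, g - h⟫_ℝ := by
  -- Convexity sharpened by a gradient term: test at `g - (1/L)(G g - G h)`, which minimizes the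
  -- quadratic upper model of `F - ⟪G h, ·⟫` at `g`. Adding this bound to its copy with `g` and `h`
  -- exchanged gives cocoercivity.
  have key : ∀ g h : H, F h + ⟪G h, g - h⟫_ℝ + 1 / (2 * L) * ‖G g - G h‖ ^ 2 ≤ F g := by
    intro g h
    have h1 := hsmooth g (-((1 / L) • (G g - G h)))
    have h2 := hconv h (g + -((1 / L) • (G g - G h)))
    have e : g + -((1 / L) • (G g - G h)) - h = (g - h) - (1 / L) • (G g - G h) := by abel
    rw [e, inner_sub_right, inner_smul_right] at h2
    rw [inner_neg_right, inner_smul_right, norm_neg, norm_smul, mul_pow, Real.norm_eq_abs,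
      sq_abs] at h1
    have h3 : ‖G g - G h‖ ^ 2 = ⟪G g, G g - G h⟫_ℝ - ⟪G h, G g - G h⟫_ℝ := by
      rw [← inner_sub_left, real_inner_self_eq_norm_sq]
    have h4 : L / 2 * ((1 / L) ^ 2 * ‖G g - G h‖ ^ 2) = 1 / (2 * L) * ‖G g - G h‖ ^ 2 := by
      field_simp
    have h5 : 1 / L * ⟪G g, G g - G h⟫_ℝ - 1 / L * ⟪G h, G g - G h⟫_ℝ
        = 2 * (1 / (2 * L) * ‖G g - G h‖ ^ 2) := by
      rw [h3]; field_simp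
    linarith
  have h1 := key g h
  have h2 := key h g
  rw [← norm_neg, neg_sub] at h2
  have h3 : ⟪G g - G h, g - h⟫_ℝ = -⟪G h, g - h⟫_ℝ - ⟪G g, h - g⟫_ℝ := by
    rw [← neg_sub g h, inner_neg_right, inner_sub_left]; ring
  have h4 : 1 / (2 * L) * ‖G g - G h‖ ^ 2 + 1 / (2 * L) * ‖G g - G h‖ ^ 2
      ≤ ⟪G g - G h, g - h⟫_ℝ := by
    rw [h3]; linarith
  have h5 : 1 / (2 * L) * ‖G g - G h‖ ^ 2 + 1 / (2 * L) * ‖G g - G h‖ ^ 2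
      = ‖G g - G h‖ ^ 2 / L := by field_simp; ring
  rw [h5, div_le_iff₀ hL] at h4
  linarith

theorem norm_gradient_step_sub_le {lam η : ℝ} (hL : 0 < L) (hlam : 0 < lam)
    (hconv : ∀ g h, F g + ⟪G g, h - g⟫_ℝ ≤ F h)
    (hsmooth : ∀ g h, F (g + h) - F g - ⟪G g, h⟫_ℝ ≤ L / 2 * ‖h‖ ^ 2)
    (hη : 0 ≤ η) (hη' : η ≤ 1 / (L + lam)) (g h : H) :
    ‖(g - η • (G g + lam • g)) - (h - η • (G h + lam • h))‖ ≤ (1 - η * lam) * ‖g - h‖ := by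
  have hs : η * (L + lam) ≤ 1 := by rwa [le_div_iff₀ (by positivity)] at hη'
  have hc := norm_sub_sq_le_of_smooth hL hconv hsmooth g h
  have e : (g - η • (G g + lam • g)) - (h - η • (G h + lam • h))
      = (1 - η * lam) • (g - h) - η • (G g - G h) := by module
  have hlam' : 0 ≤ 1 - η * lam := by nlinarith
  have hcoef : η * L ≤ 1 - η * lam := by linarith
  apply le_of_sq_le_sq _ (by positivity)
  rw [e, norm_sub_sq_real, norm_smul, norm_smul, inner_smul_left, inner_smul_right, mul_pow,
    mul_pow, Real.norm_eq_abs, Real.norm_eq_abs, sq_abs, sq_abs, real_inner_comm, mul_pow]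
  simp only [conj_trivial]
  set u := ⟪G g - G h, g - h⟫_ℝ
  have hu : 0 ≤ u := by
    by_contra hu
    nlinarith [sq_nonneg ‖G g - G h‖]
  -- Cocoercivity and `ηL ≤ 1 - ηλ` let half of the cross term `-2η(1 - ηλ)u` absorb the square of
  -- the gradient difference.
  have h1 : η ^ 2 * ‖G g - G h‖ ^ 2 ≤ η * ((1 - η * lam) * u) := by
    calc η ^ 2 * ‖G g - G h‖ ^ 2 ≤ η ^ 2 * (L * u) := by gcongr
      _ = η * (η * L * u) := by ring
      _ ≤ _ := by gcongr
  have h2 : 0 ≤ η * ((1 - η * lam) * u) := by positivity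
  nlinarith

/-- Banach's fixed point theorem for the gradient step of length `1/(L + λ)`; no weak compactness is
needed. -/
theorem exists_regularized_critical_point [CompleteSpace H] {lam : ℝ} (hL : 0 < L)
    (hlam : 0 < lam) (hconv : ∀ g h, F g + ⟪G g, h - g⟫_ℝ ≤ F h)
    (hsmooth : ∀ g h, F (g + h) - F g - ⟪G g, h⟫_ℝ ≤ L / 2 * ‖h‖ ^ 2) :
    ∃ gl, G gl + lam • gl = 0 := by
  set η := 1 / (L + lam) with hη
  have hη0 : 0 < η := by positivity
  have hlt : η * lam < 1 := by rw [hη, div_mul_eq_mul_div, div_lt_one (by positivity)]; linarith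
  have hcontr : ContractingWith (1 - η * lam).toNNReal fun g => g - η • (G g + lam • g) := by
    refine ⟨?_, LipschitzWith.of_dist_le_mul fun g h => ?_⟩
    · rw [← NNReal.coe_lt_coe, Real.coe_toNNReal _ (by linarith)]
      have : 0 < η * lam := by positivity
      simpa using this
    · rw [dist_eq_norm, dist_eq_norm, Real.coe_toNNReal _ (by linarith)]
      exact norm_gradient_step_sub_le hL hlam hconv hsmooth hη0.le le_rfl g h
  have := hcontr.fixedPoint_isFixedPt
  refine ⟨hcontr.fixedPoint _, ?_⟩
  have h2 := sub_eq_self.1 this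
  exact (smul_eq_zero.1 h2).resolve_left hη0.ne'

theorem regularized_quadratic_growth {lam : ℝ} {gl : H}
    (hconv : ∀ g h, F g + ⟪G g, h - g⟫_ℝ ≤ F h) (hgl : G gl + lam • gl = 0) (g : H) :
    F gl + lam / 2 * ‖gl‖ ^ 2 + lam / 2 * ‖g - gl‖ ^ 2 ≤ F g + lam / 2 * ‖g‖ ^ 2 := by
  have h1 := hconv gl g
  rw [eq_neg_of_add_eq_zero_left hgl, inner_neg_left, inner_smul_left] at h1
  have h2 : ‖g‖ ^ 2 = ‖gl‖ ^ 2 + 2 * ⟪gl, g - gl⟫_ℝ + ‖g - gl‖ ^ 2 := by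
    rw [← norm_add_sq_real, add_sub_cancel]
  rw [h2]
  simp only [conj_trivial] at h1
  linarith

/-- Add the two quadratic growth inequalities, each tested at the other minimizer. The bound makes
the path Cauchy as soon as its norms are bounded, because they increase as the parameter decreases.
-/
theorem norm_sub_sq_le_of_regularized {lam mu : ℝ} {gl gm : H} (hlam : 0 < lam)
    (hlm : lam ≤ mu) (hconv : ∀ g h, F g + ⟪G g, h - g⟫_ℝ ≤ F h)
    (hgl : G gl + lam • gl = 0) (hgm : G gm + mu • gm = 0) :
    ‖gl - gm‖ ^ 2 ≤ ‖gl‖ ^ 2 - ‖gm‖ ^ 2 := by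
  have h1 := regularized_quadratic_growth hconv hgl gm
  have h2 := regularized_quadratic_growth hconv hgm gl
  rw [norm_sub_rev gm gl] at h1
  have h3 : lam * ‖gl - gm‖ ^ 2 + (mu - lam) / 2 * ‖gl - gm‖ ^ 2
      ≤ (mu - lam) / 2 * (‖gl‖ ^ 2 - ‖gm‖ ^ 2) := by linarith
  have h5 : 0 ≤ ‖gl - gm‖ ^ 2 := by positivity
  rcases hlm.eq_or_lt with rfl | hlt
  · have : ‖gl - gm‖ ^ 2 ≤ 0 := by
      by_contra h; push Not at h; nlinarith
    have h4 : gl = gm := sub_eq_zero.1 (norm_eq_zero.1 (pow_eq_zero_iff (by norm_num) |>.1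
      (le_antisymm this h5)))
    simp [h4]
  · have : 0 < (mu - lam) / 2 := by linarith
    have h6 : (mu - lam) / 2 * ‖gl - gm‖ ^ 2 ≤ (mu - lam) / 2 * (‖gl‖ ^ 2 - ‖gm‖ ^ 2) := by
      have : 0 ≤ lam * ‖gl - gm‖ ^ 2 := by positivity
      linarith
    exact le_of_mul_le_mul_left h6 this

open Filter Topology in
theorem exists_tendsto_regularized [CompleteSpace H] {gl : ℝ → H} {gs : H}
    (hconv : ∀ g h, F g + ⟪G g, h - g⟫_ℝ ≤ F h)
    (hgl : ∀ lam, 0 < lam → G (gl lam) + lam • gl lam = 0) (hgs : ∀ g, F gs ≤ F g) :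
    ∃ g₀, Tendsto gl (𝓝[>] 0) (𝓝 g₀) ∧ F g₀ ≤ F gs := by
  have hbdd : ∀ lam, 0 < lam → ‖gl lam‖ ^ 2 ≤ ‖gs‖ ^ 2 := by
    intro lam hlam
    have h1 := regularized_quadratic_growth hconv (hgl lam hlam) gs
    have h2 := hgs (gl lam)
    have h3 : 0 ≤ lam / 2 * ‖gs - gl lam‖ ^ 2 := by positivity
    have h4 : lam / 2 * ‖gl lam‖ ^ 2 ≤ lam / 2 * ‖gs‖ ^ 2 := by linarith
    exact le_of_mul_le_mul_left h4 (by positivity)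
  set A := (fun lam => ‖gl lam‖ ^ 2) '' Ioi 0 with hA
  have hAne : A.Nonempty := ⟨_, 1, by simp, rfl⟩
  have hAb : BddAbove A := ⟨‖gs‖ ^ 2, by rintro _ ⟨lam, hlam, rfl⟩; exact hbdd lam hlam⟩
  have hcau : Cauchy (map gl (𝓝[>] 0)) := by
    rw [Metric.cauchy_iff]
    refine ⟨inferInstance, fun ε hε => ?_⟩
    -- Once `‖gl l₀‖²` is within `(ε/2)²` of the supremum, all later points of the path lie within
    -- `ε/2` of `gl l₀`.
    obtain ⟨_, ⟨l₀, hl₀, rfl⟩, hlt⟩ := exists_lt_of_lt_csSup hAne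
      (sub_lt_self (sSup A) (by positivity : 0 < (ε / 2) ^ 2))
    have hpos : (0 : ℝ) < l₀ := hl₀
    have hnear : ∀ lam, 0 < lam → lam ≤ l₀ → ‖gl lam - gl l₀‖ < ε / 2 := by
      intro lam hlam hle
      have h1 := norm_sub_sq_le_of_regularized hlam hle hconv (hgl lam hlam) (hgl l₀ hpos)
      have h2 : ‖gl lam‖ ^ 2 ≤ sSup A := le_csSup hAb ⟨lam, hlam, rfl⟩
      exact lt_of_pow_lt_pow_left₀ 2 (by positivity) (by simp only at hlt; linarith)
    refine ⟨gl '' Ioc 0 l₀, image_mem_map (Ioc_mem_nhdsGT hpos), ?_⟩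
    rintro _ ⟨a, ha, rfl⟩ _ ⟨b, hb, rfl⟩
    calc dist (gl a) (gl b) ≤ dist (gl a) (gl l₀) + dist (gl b) (gl l₀) :=
          dist_triangle_right _ _ _
      _ < ε / 2 + ε / 2 := by
          rw [dist_eq_norm, dist_eq_norm]
          exact add_lt_add (hnear a ha.1 ha.2) (hnear b hb.1 hb.2)
      _ = ε := by ring
  obtain ⟨g₀, hg₀⟩ := cauchy_map_iff_exists_tendsto.1 hcau
  refine ⟨g₀, hg₀, ?_⟩
  -- The tangent inequality at `g₀` supplies lower semicontinuity along the path, so continuity of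
  -- `F` is not required.
  have hlim : Tendsto (fun lam => F gs + lam / 2 * ‖gs‖ ^ 2 + ⟪G g₀, g₀ - gl lam⟫_ℝ) (𝓝[>] 0)
      (𝓝 (F gs + 0 / 2 * ‖gs‖ ^ 2 + ⟪G g₀, g₀ - g₀⟫_ℝ)) := by
    have h0 : Tendsto (fun lam : ℝ => lam) (𝓝[>] 0) (𝓝 0) := tendsto_nhdsWithin_of_tendsto_nhds
      tendsto_id
    exact (((h0.div_const 2).mul_const _).const_add _).add
      (tendsto_const_nhds.inner (hg₀.const_sub _))
  simp only [sub_self, inner_zero_right, zero_div, zero_mul, add_zero] at hlim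
  refine ge_of_tendsto hlim (eventually_nhdsWithin_of_forall fun lam hlam => ?_)
  have hlam' : (0 : ℝ) < lam := hlam
  have h1 := regularized_quadratic_growth hconv (hgl lam hlam) gs
  have h2 := hconv g₀ (gl lam)
  rw [← neg_sub g₀ (gl lam), inner_neg_right] at h2
  have h3 : 0 ≤ lam / 2 * ‖gs - gl lam‖ ^ 2 := by positivity
  have h4 : 0 ≤ lam / 2 * ‖gl lam‖ ^ 2 := by positivity
  linarith

end Convex

/-! ### A hyperbolic cosine inequality in Hilbert space -/

section Cosh

/-- The series of `cosh √s` is `∑ s^n/(2n)!`, a nonnegative combination of functions convex on `s ≥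
0`. -/
theorem cosh_sqrt_convex {w₁ w₂ s₁ s₂ : ℝ} (hw₁ : 0 ≤ w₁) (hw₂ : 0 ≤ w₂) (hw : w₁ + w₂ = 1)
    (hs₁ : 0 ≤ s₁) (hs₂ : 0 ≤ s₂) :
    Real.cosh √(w₁ * s₁ + w₂ * s₂) ≤ w₁ * Real.cosh √s₁ + w₂ * Real.cosh √s₂ := by
  have hser : ∀ s : ℝ, 0 ≤ s →
      HasSum (fun n : ℕ => s ^ n / (2 * n).factorial) (Real.cosh √s) := by
    intro s hs
    simpa only [pow_mul, Real.sq_sqrt hs] using Real.hasSum_cosh √s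
  refine hasSum_le (fun n => ?_) (hser _ (by positivity))
    (((hser _ hs₁).mul_left w₁).add ((hser _ hs₂).mul_left w₂))
  have := (convexOn_pow (𝕜 := ℝ) n).2 hs₁ hs₂ hw₁ hw₂ hw
  simp only [smul_eq_mul] at this
  rw [← mul_div_assoc, ← mul_div_assoc, ← add_div]
  gcongr

theorem exists_cosh_sqrt_le {a c : ℝ} (ha : 0 ≤ a) (hc : 0 ≤ c) :
    ∃ q : ℝ, ∀ p : ℝ, |p| ≤ a * c →
      Real.cosh √(a ^ 2 + c ^ 2 + 2 * p) ≤ Real.cosh a * Real.cosh c + q * p := by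
  refine ⟨Real.sinh a * Real.sinh c / (a * c), fun p hp => ?_⟩
  rcases (mul_nonneg ha hc).eq_or_lt with h0 | hpos
  · have hp0 : p = 0 := abs_nonpos_iff.1 (hp.trans h0.ge)
    subst hp0
    rcases mul_eq_zero.1 h0.symm with rfl | rfl
    · simp [Real.sqrt_sq hc]
    · simp [Real.sqrt_sq ha]
  · obtain ⟨hp1, hp2⟩ := abs_le.1 hp
    have h1 : -1 ≤ p / (a * c) := by rw [le_div_iff₀ hpos]; linarith
    have h2 : p / (a * c) ≤ 1 := by rw [div_le_one hpos]; linarith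
    set u := p / (a * c) with hu
    have hpu : p = u * (a * c) := by rw [hu, div_mul_cancel₀ _ hpos.ne']
    -- The argument `a² + c² + 2p` is the average of `(a + c)²` and `(a - c)²` with these weights;
    -- the bound is the chord of a convex function, hence affine in `p`.
    have := cosh_sqrt_convex (w₁ := (1 + u) / 2) (w₂ := (1 - u) / 2) (by linarith) (by linarith)
      (by ring) (sq_nonneg (a + c)) (sq_nonneg (a - c))
    rw [Real.sqrt_sq_eq_abs, Real.sqrt_sq_eq_abs, Real.cosh_abs, Real.cosh_abs, Real.cosh_add,
      Real.cosh_sub] at this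
    calc Real.cosh √(a ^ 2 + c ^ 2 + 2 * p)
        = Real.cosh √((1 + u) / 2 * (a + c) ^ 2 + (1 - u) / 2 * (a - c) ^ 2) := by
          rw [hpu]; ring_nf
      _ ≤ _ := this
      _ = Real.cosh a * Real.cosh c + Real.sinh a * Real.sinh c / (a * c) * p := by
          rw [hu]; ring

/-- The coefficient `q` is chosen before `d`, so the last term is linear in `d` and vanishes when
averaged over centred noise. -/
theorem exists_cosh_norm_add_le {H : Type*} [NormedAddCommGroup H] [InnerProductSpace ℝ H]
    (x : H) {c : ℝ} (hc : 0 ≤ c) :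
    ∃ q : ℝ, ∀ d : H, ‖d‖ ≤ c →
      Real.cosh ‖x + d‖ ≤ Real.cosh ‖x‖ * Real.cosh c + q * ⟪x, d⟫_ℝ := by
  obtain ⟨q, hq⟩ := exists_cosh_sqrt_le (norm_nonneg x) hc
  refine ⟨q, fun d hd => le_trans ?_ (hq ⟪x, d⟫_ℝ ?_)⟩
  · rw [Real.cosh_le_cosh, abs_norm, abs_of_nonneg (Real.sqrt_nonneg _)]
    apply Real.le_sqrt_of_sq_le
    rw [norm_add_sq_real]
    have : ‖d‖ ^ 2 ≤ c ^ 2 := by gcongr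
    linarith
  · exact (abs_real_inner_le_norm x d).trans (by gcongr)

end Cosh

end KernelSGD

namespace KernelSGD

/-! ### The loss function -/

section Loss

variable {φ : ℝ → ℝ} {M : ℝ}

theorem measurable_lab : Measurable lab := measurable_of_countable _

theorem lossDeriv_eq (hφ : Differentiable ℝ φ) (ζ : ℝ) (y : ℤˣ) :
    lossDeriv φ ζ y = lab y * deriv φ (lab y * ζ) := by
  have h : HasDerivAt (fun u => loss φ u y) (deriv φ (lab y * ζ) * (lab y * 1)) ζ :=
    (hφ (lab y * ζ)).hasDerivAt.comp ζ ((hasDerivAt_id ζ).const_mul (lab y))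
  rw [lossDeriv, h.deriv]
  ring

theorem convexOn_tangent_le (hφ : Differentiable ℝ φ) (hc : ConvexOn ℝ univ φ) (a b : ℝ) :
    φ a + deriv φ a * (b - a) ≤ φ b := by
  rcases lt_trichotomy a b with h | rfl | h
  · have := hc.deriv_le_slope (mem_univ a) (mem_univ b) h (hφ a)
    rw [slope_def_field, le_div_iff₀ (by linarith)] at this
    linarith
  · simp
  · have := hc.slope_le_deriv (mem_univ b) (mem_univ a) h (hφ a)
    rw [slope_def_field, div_le_iff₀ (by linarith)] at this
    linarith

theorem loss_tangent_le (hφ : Differentiable ℝ φ) (hc : ConvexOn ℝ univ φ) (a b : ℝ) (y : ℤˣ) :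
    loss φ a y + lossDeriv φ a y * (b - a) ≤ loss φ b y := by
  have := convexOn_tangent_le hφ hc (lab y * a) (lab y * b)
  rw [lossDeriv_eq hφ, loss, loss]
  linarith

theorem loss_le (hφ : Differentiable ℝ φ) (hc : ConvexOn ℝ univ φ)
    (hM : ∀ (ζ : ℝ) (y : ℤˣ), |lossDeriv φ ζ y| ≤ M) (a : ℝ) (y : ℤˣ) :
    loss φ a y ≤ φ 0 + M * |a| := by
  have h1 := loss_tangent_le hφ hc a 0 y
  have h2 : lossDeriv φ a y * a ≤ M * |a| :=
    (le_abs_self _).trans (by rw [abs_mul]; gcongr; exact hM a y)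
  have h3 : loss φ 0 y = φ 0 := by simp [loss]
  linarith

theorem measurable_loss (hφ : Differentiable ℝ φ) :
    Measurable fun p : ℝ × ℤˣ => loss φ p.1 p.2 :=
  hφ.continuous.measurable.comp ((measurable_lab.comp measurable_snd).mul measurable_fst)

theorem measurable_lossDeriv (hφ : Differentiable ℝ φ) :
    Measurable fun p : ℝ × ℤˣ => lossDeriv φ p.1 p.2 := by
  simp_rw [lossDeriv_eq hφ]
  exact (measurable_lab.comp measurable_snd).mul
    ((measurable_deriv φ).comp ((measurable_lab.comp measurable_snd).mul measurable_fst))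

end Loss

/-! ### Reproducing kernel Hilbert spaces with a bounded measurable kernel -/

section Kernel

variable {X : Type*} {H : Type*} [NormedAddCommGroup H] [InnerProductSpace ℝ H] [CompleteSpace H]
  [RKHS ℝ H X ℝ] {R : ℝ}

theorem inner_feature (g : H) (x : X) : ⟪g, feature H x⟫_ℝ = g x := by
  simp [feature]

theorem feature_apply (x x' : X) : feature H x x' = ker H x' x := by
  rw [feature, RKHS.kerFun_apply, ker]

theorem norm_feature_sq (x : X) : ‖feature H x‖ ^ 2 = ker H x x := by
  rw [← real_inner_self_eq_norm_sq, inner_feature, feature_apply]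

theorem norm_feature_le (hR : 0 ≤ R) (hker : ∀ x : X, ker H x x ≤ R ^ 2) (x : X) :
    ‖feature H x‖ ≤ R :=
  le_of_sq_le_sq ((norm_feature_sq x).trans_le (hker x)) hR

theorem abs_apply_le (hR : 0 ≤ R) (hker : ∀ x : X, ker H x x ≤ R ^ 2) (g : H) (x : X) :
    |g x| ≤ R * ‖g‖ := by
  rw [← inner_feature, mul_comm]
  exact (abs_real_inner_le_norm _ _).trans (by gcongr; exact norm_feature_le hR hker x)

theorem measurable_feature [MeasurableSpace X]
    (hker : Measurable fun p : X × X => ker H p.1 p.2) (x : X) :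
    Measurable (feature H x : X → ℝ) := by
  have h : Measurable fun x' => ker H x' x := hker.of_uncurry_right
  exact (funext (feature_apply x) : (feature H x : X → ℝ) = fun x' => ker H x' x) ▸ h

/-- Kernel sections are measurable and span a dense subspace, and norm convergence in `H` implies
pointwise convergence. -/
theorem measurable_coe [MeasurableSpace X] (hker : Measurable fun p : X × X => ker H p.1 p.2)
    (g : H) : Measurable (g : X → ℝ) := by
  let S : Submodule ℝ H :=
    { carrier := {g | Measurable (g : X → ℝ)}
      add_mem' := fun {a b} ha hb => by
        simp only [Set.mem_ofPred_eq, RKHS.coe_add] at *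
        exact ha.add hb
      zero_mem' := by simpa using measurable_zero
      smul_mem' := fun c a ha => by
        simp only [Set.mem_ofPred_eq, RKHS.coe_smul] at *
        exact ha.const_smul c }
  have hspan : Submodule.span ℝ {RKHS.kerFun H x v | (x : X) (v : ℝ)} ≤ S := by
    rw [Submodule.span_le]
    rintro _ ⟨x, v, rfl⟩
    have e : RKHS.kerFun H x v = v • feature H x := by
      rw [feature, ← map_smul, smul_eq_mul, mul_one]
    rw [e]
    refine S.smul_mem v ?_
    exact measurable_feature hker x
  have hg : g ∈ S.topologicalClosure := by
    have h := Submodule.topologicalClosure_mono hspan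
    have htop := RKHS.kerFun_dense (𝕜 := ℝ) (X := X) (V := ℝ) H
    rw [htop] at h
    exact h Submodule.mem_top
  obtain ⟨u, hu, hlim⟩ : ∃ u : ℕ → H, (∀ n, u n ∈ S) ∧ Filter.Tendsto u Filter.atTop (nhds g) :=
    mem_closure_iff_seq_limit.1 hg
  refine measurable_of_tendsto_metrizable (f := fun n => (u n : X → ℝ)) hu ?_
  rw [tendsto_pi_nhds]
  exact fun x => ((RKHS.continuous_eval x).tendsto g).comp hlim

end Kernel

/-! ### The expected risk on the reproducing kernel Hilbert space -/

section Risk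

variable {X : Type*} [MeasurableSpace X] {H : Type*} [NormedAddCommGroup H]
  [InnerProductSpace ℝ H] [CompleteSpace H] [RKHS ℝ H X ℝ]

/-- A smooth convex Lipschitz loss together with a bounded measurable kernel. -/
structure SmoothProblem (H : Type*) [NormedAddCommGroup H] [InnerProductSpace ℝ H]
    [CompleteSpace H] [RKHS ℝ H X ℝ] (φ : ℝ → ℝ) (ρ : Measure (X × ℤˣ)) (M L R : ℝ) : Prop where
  measurable_ker : Measurable fun p : X × X => ker H p.1 p.2
  nonneg : ∀ v, 0 ≤ φ v
  differentiable : Differentiable ℝ φ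
  convex : ConvexOn ℝ univ φ
  M_pos : 0 < M
  abs_lossDeriv_le : ∀ (ζ : ℝ) (y : ℤˣ), |lossDeriv φ ζ y| ≤ M
  L_pos : 0 < L
  smooth : ∀ g h : H, |riskH φ ρ (g + h) - riskH φ ρ g - ⟪gradient (riskH φ ρ) g, h⟫_ℝ|
    ≤ L / 2 * ‖h‖ ^ 2
  R_pos : 0 < R
  ker_le : ∀ x : X, ker H x x ≤ R ^ 2

namespace SmoothProblem

variable {φ : ℝ → ℝ} {ρ : Measure (X × ℤˣ)} [IsProbabilityMeasure ρ] {M L R : ℝ}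

omit [IsProbabilityMeasure ρ] in
theorem measurable_coe (hP : SmoothProblem H φ ρ M L R) (g : H) : Measurable (g : X → ℝ) :=
  KernelSGD.measurable_coe hP.measurable_ker g

theorem integrable_loss (hP : SmoothProblem H φ ρ M L R) (g : H) :
    Integrable (fun z : X × ℤˣ => loss φ (g z.1) z.2) ρ := by
  refine Integrable.of_bound (C := φ 0 + M * (R * ‖g‖)) ?_ (ae_of_all _ fun z => ?_)
  · exact ((measurable_loss hP.differentiable).comp
      (((hP.measurable_coe g).comp measurable_fst).prodMk measurable_snd)).aestronglyMeasurable
  · rw [Real.norm_eq_abs, abs_of_nonneg (show 0 ≤ loss φ (g z.1) z.2 from hP.nonneg _)]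
    have h := abs_apply_le hP.R_pos.le hP.ker_le g z.1
    have hM := hP.M_pos
    refine (loss_le hP.differentiable hP.convex hP.abs_lossDeriv_le _ _).trans ?_
    gcongr

omit [IsProbabilityMeasure ρ] in
theorem abs_lossDeriv_mul_le (hP : SmoothProblem H φ ρ M L R) (a : ℝ) (y : ℤˣ) (h : H) (x : X) :
    |lossDeriv φ a y * h x| ≤ M * R * ‖h‖ := by
  rw [abs_mul, mul_assoc]
  exact mul_le_mul (hP.abs_lossDeriv_le _ _) (abs_apply_le hP.R_pos.le hP.ker_le h x)
    (abs_nonneg _) hP.M_pos.le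

theorem integrable_lossDeriv_mul (hP : SmoothProblem H φ ρ M L R) (g h : H) :
    Integrable (fun z : X × ℤˣ => lossDeriv φ (g z.1) z.2 * h z.1) ρ := by
  refine Integrable.of_bound (C := M * R * ‖h‖) ?_
    (ae_of_all _ fun z => hP.abs_lossDeriv_mul_le _ _ h z.1)
  exact (((measurable_lossDeriv hP.differentiable).comp
    (((hP.measurable_coe g).comp measurable_fst).prodMk measurable_snd)).mul
    ((hP.measurable_coe h).comp measurable_fst)).aestronglyMeasurable

theorem riskH_tangent_le (hP : SmoothProblem H φ ρ M L R) (g h : H) :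
    riskH φ ρ g + ∫ z, lossDeriv φ (g z.1) z.2 * h z.1 ∂ρ ≤ riskH φ ρ (g + h) := by
  rw [riskH, riskH, risk, risk, ← integral_add (hP.integrable_loss g)
    (hP.integrable_lossDeriv_mul g h)]
  refine integral_mono ((hP.integrable_loss g).add (hP.integrable_lossDeriv_mul g h))
    (hP.integrable_loss _) fun z => ?_
  have := loss_tangent_le hP.differentiable hP.convex (g z.1) ((g + h : H) z.1) z.2
  simpa using this

theorem eq_zero_of_forall_mul_le {d c : ℝ} (hc : 0 ≤ c) (h : ∀ t : ℝ, t * d ≤ c * t ^ 2) :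
    d = 0 := by
  -- At `t = d/(c + 1)` one has `td - ct² = t²`; the shift by `1` covers `c = 0`.
  have h1 := h (d / (c + 1))
  have h2 : d / (c + 1) * d - c * (d / (c + 1)) ^ 2 = (d / (c + 1)) ^ 2 := by
    field_simp; ring
  have h3 : (d / (c + 1)) ^ 2 = 0 := le_antisymm (by linarith) (sq_nonneg _)
  have h4 := pow_eq_zero_iff (by norm_num) |>.1 h3
  rcases div_eq_zero_iff.1 h4 with h5 | h5
  · exact h5
  · linarith

/-- No differentiation under the integral: the integral functional is a subgradient, while the
gradient gives an upper bound with quadratic error. Along `t • h` their difference is linear in `t`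
and at most quadratic, so it is zero. -/
theorem inner_gradient (hP : SmoothProblem H φ ρ M L R) (g h : H) :
    ⟪gradient (riskH φ ρ) g, h⟫_ℝ = ∫ z, lossDeriv φ (g z.1) z.2 * h z.1 ∂ρ := by
  have hL := hP.L_pos
  refine (sub_eq_zero.1 (eq_zero_of_forall_mul_le (c := L / 2 * ‖h‖ ^ 2) (by positivity)
    fun t => ?_)).symm
  have h1 := hP.riskH_tangent_le g (t • h)
  have h2 := (le_abs_self _).trans (hP.smooth g (t • h))
  rw [inner_smul_right, norm_smul, mul_pow, Real.norm_eq_abs, sq_abs] at h2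
  have h3 : ∫ z, lossDeriv φ (g z.1) z.2 * (t • h : H) z.1 ∂ρ
      = t * ∫ z, lossDeriv φ (g z.1) z.2 * h z.1 ∂ρ := by
    rw [← integral_const_mul]
    congr 1 with z
    simp only [RKHS.coe_smul, Pi.smul_apply, smul_eq_mul]
    ring
  rw [h3] at h1
  linarith

theorem gradient_tangent_le (hP : SmoothProblem H φ ρ M L R) (g h : H) :
    riskH φ ρ g + ⟪gradient (riskH φ ρ) g, h - g⟫_ℝ ≤ riskH φ ρ h := by
  have := hP.riskH_tangent_le g (h - g)
  rwa [← hP.inner_gradient, add_sub_cancel] at this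

omit [IsProbabilityMeasure ρ] in
theorem gradient_smooth (hP : SmoothProblem H φ ρ M L R) (g h : H) :
    riskH φ ρ (g + h) - riskH φ ρ g - ⟪gradient (riskH φ ρ) g, h⟫_ℝ ≤ L / 2 * ‖h‖ ^ 2 :=
  (le_abs_self _).trans (hP.smooth g h)

theorem norm_gradient_le (hP : SmoothProblem H φ ρ M L R) (g : H) :
    ‖gradient (riskH φ ρ) g‖ ≤ M * R := by
  set G := gradient (riskH φ ρ) g with hG
  have h1 : ‖G‖ ^ 2 ≤ M * R * ‖G‖ := by
    rw [← real_inner_self_eq_norm_sq, hG, hP.inner_gradient, ← hG]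
    have := norm_integral_le_of_norm_le_const (μ := ρ) (f := fun z : X × ℤˣ => lossDeriv φ (g z.1) z.2 * G z.1)
      (ae_of_all _ fun z => hP.abs_lossDeriv_mul_le (g z.1) z.2 G z.1)
    simp only [probReal_univ, mul_one] at this
    exact (le_abs_self _).trans this
  have := hP.M_pos
  have := hP.R_pos
  rcases (norm_nonneg G).eq_or_lt with h0 | h0
  · rw [← h0]; positivity
  · exact le_of_mul_le_mul_right (by nlinarith) h0

theorem norm_stochGrad_sub_gradient_le (hP : SmoothProblem H φ ρ M L R) (g : H) (z : X × ℤˣ) :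
    ‖stochGrad φ g z - gradient (riskH φ ρ) g‖ ≤ 2 * M * R := by
  have h1 := hP.norm_gradient_le g
  have h2 : ‖stochGrad φ g z‖ ≤ M * R := by
    rw [stochGrad, norm_smul]
    exact mul_le_mul (hP.abs_lossDeriv_le _ _) (norm_feature_le hP.R_pos.le hP.ker_le _)
      (norm_nonneg _) hP.M_pos.le
  exact (norm_sub_le _ _).trans (by linarith)

omit [MeasurableSpace X] in
theorem inner_stochGrad (g h : H) (z : X × ℤˣ) :
    ⟪h, stochGrad φ g z⟫_ℝ = lossDeriv φ (g z.1) z.2 * h z.1 := by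
  rw [stochGrad, inner_smul_right, inner_feature]

theorem integrable_inner_noise (hP : SmoothProblem H φ ρ M L R) (g h : H) :
    Integrable (fun z => ⟪h, stochGrad φ g z - gradient (riskH φ ρ) g⟫_ℝ) ρ := by
  simp_rw [inner_sub_right, inner_stochGrad]
  exact (hP.integrable_lossDeriv_mul g h).sub (integrable_const _)

theorem integral_inner_noise (hP : SmoothProblem H φ ρ M L R) (g h : H) :
    ∫ z, ⟪h, stochGrad φ g z - gradient (riskH φ ρ) g⟫_ℝ ∂ρ = 0 := by
  simp_rw [inner_sub_right, inner_stochGrad]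
  rw [integral_sub (hP.integrable_lossDeriv_mul g h) (integrable_const _), ← hP.inner_gradient,
    real_inner_comm]
  simp

/-- One step of regularized stochastic gradient descent contracts the exponential moments of the
distance to the regularized minimizer. -/
theorem lintegral_cosh_step_le (hP : SmoothProblem H φ ρ M L R) {lam η θ : ℝ} (hlam : 0 < lam)
    (hη : 0 ≤ η) (hη' : η ≤ 1 / (L + lam)) (hθ : 0 ≤ θ) {gl : H}
    (hgl : gradient (riskH φ ρ) gl + lam • gl = 0) (g : H) :
    ∫⁻ z, ENNReal.ofReal (Real.cosh (θ * ‖g - η • regStochGrad φ lam g z - gl‖)) ∂ρ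
      ≤ ENNReal.ofReal (Real.cosh (θ * ((1 - η * lam) * ‖g - gl‖))
          * Real.exp (θ ^ 2 * η ^ 2 * (2 * M * R) ^ 2 / 2)) := by
  have hM := hP.M_pos
  have hR := hP.R_pos
  set G := gradient (riskH φ ρ) g with hG
  set v : H := (g - η • (G + lam • g)) - (gl - η • (gradient (riskH φ ρ) gl + lam • gl)) with hv
  have hvn : ‖v‖ ≤ (1 - η * lam) * ‖g - gl‖ :=
    norm_gradient_step_sub_le hP.L_pos hlam hP.gradient_tangent_le hP.gradient_smooth hη hη' g gl
  have hdec : ∀ z, θ * ‖g - η • regStochGrad φ lam g z - gl‖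
      = ‖θ • v + (-(θ * η)) • (stochGrad φ g z - G)‖ := by
    intro z
    have e : θ • v + (-(θ * η)) • (stochGrad φ g z - G)
        = θ • (g - η • regStochGrad φ lam g z - gl) := by
      rw [hv, hgl, regStochGrad]; module
    rw [e, norm_smul, Real.norm_eq_abs, abs_of_nonneg hθ]
  -- Upper bound for the norm of the scaled noise `θη(stochGrad - G)`.
  set c := θ * η * (2 * M * R) with hc
  obtain ⟨q, hq⟩ := exists_cosh_norm_add_le (θ • v) (c := c) (by positivity)
  have hbound : ∀ z, Real.cosh (θ * ‖g - η • regStochGrad φ lam g z - gl‖)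
      ≤ Real.cosh ‖θ • v‖ * Real.cosh c
        + q * ⟪θ • v, (-(θ * η)) • (stochGrad φ g z - G)⟫_ℝ := by
    intro z
    rw [hdec]
    refine hq _ ?_
    rw [norm_smul, norm_neg, Real.norm_eq_abs, abs_of_nonneg (by positivity), hc]
    gcongr
    exact hP.norm_stochGrad_sub_gradient_le g z
  have hint : Integrable (fun z => Real.cosh ‖θ • v‖ * Real.cosh c
        + q * ⟪θ • v, (-(θ * η)) • (stochGrad φ g z - G)⟫_ℝ) ρ := by
    simp_rw [inner_smul_right]
    exact (integrable_const _).add (((hP.integrable_inner_noise g _).const_mul _).const_mul _)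
  have hval : ∫ z, (Real.cosh ‖θ • v‖ * Real.cosh c
        + q * ⟪θ • v, (-(θ * η)) • (stochGrad φ g z - G)⟫_ℝ) ∂ρ
      = Real.cosh ‖θ • v‖ * Real.cosh c := by
    simp_rw [inner_smul_right]
    rw [integral_add (integrable_const _)
      (((hP.integrable_inner_noise g _).const_mul _).const_mul _), integral_const,
      integral_const_mul q, integral_const_mul (-(θ * η)), hP.integral_inner_noise]
    simp
  calc ∫⁻ z, ENNReal.ofReal (Real.cosh (θ * ‖g - η • regStochGrad φ lam g z - gl‖)) ∂ρ
      ≤ ∫⁻ z, ENNReal.ofReal (Real.cosh ‖θ • v‖ * Real.cosh c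
        + q * ⟪θ • v, (-(θ * η)) • (stochGrad φ g z - G)⟫_ℝ) ∂ρ :=
        lintegral_mono fun z => ENNReal.ofReal_le_ofReal (hbound z)
    _ = ENNReal.ofReal (Real.cosh ‖θ • v‖ * Real.cosh c) := by
        rw [← ofReal_integral_eq_lintegral_ofReal hint (ae_of_all _ fun z =>
          (Real.cosh_pos _).le.trans (hbound z)), hval]
    _ ≤ _ := by
        refine ENNReal.ofReal_le_ofReal (mul_le_mul ?_ ?_ (Real.cosh_pos _).le (Real.cosh_pos _).le)
        · rw [Real.cosh_le_cosh, abs_norm, norm_smul, Real.norm_eq_abs, abs_of_nonneg hθ]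
          exact (mul_le_mul_of_nonneg_left hvn hθ).trans (le_abs_self _)
        · refine (Real.cosh_le_exp_half_sq c).trans (Real.exp_le_exp.2 (le_of_eq ?_))
          rw [hc]; ring

end SmoothProblem

end Risk

end KernelSGD

namespace KernelSGD

/-! ### Measurability of stochastic gradient descent -/

section Measurability

variable {X : Type*} [MeasurableSpace X] {H : Type*} [NormedAddCommGroup H]
  [InnerProductSpace ℝ H] [CompleteSpace H] [RKHS ℝ H X ℝ] {A : Type*} [MeasurableSpace A]

theorem measurable_ker_comp (hker : Measurable fun p : X × X => ker H p.1 p.2) {f g : A → X}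
    (hf : Measurable f) (hg : Measurable g) : Measurable fun a => ker H (f a) (g a) := by
  have h := hker.comp (hf.prodMk hg)
  simpa only [Function.comp_def] using h

/-- A random element of a possibly nonseparable reproducing kernel Hilbert space whose evaluations,
norm and inner products are measurable. -/
structure WeaklyMeasurable (G : A → H) : Prop where
  eval : Measurable fun p : A × X => G p.1 p.2
  norm : Measurable fun a => ‖G a‖
  inner : ∀ h, Measurable fun a => ⟪G a, h⟫_ℝ

namespace WeaklyMeasurable

theorem const (hker : Measurable fun p : X × X => ker H p.1 p.2) (g : H) :
    WeaklyMeasurable fun _ : A => g :=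
  ⟨(measurable_coe hker g).comp measurable_snd, measurable_const, fun _ => measurable_const⟩

/-- Expanding the square by the reproducing property expresses the new norm through the old norm, an
evaluation and the kernel, so `H` need not be separable. -/
theorem smul_add_smul_feature (hker : Measurable fun p : X × X => ker H p.1 p.2) {G : A → H}
    (hG : WeaklyMeasurable G) (α : ℝ) {c : A → ℝ} (hc : Measurable c) {x : A → X}
    (hx : Measurable x) : WeaklyMeasurable fun a => α • G a + c a • feature H (x a) := by
  have hGx : Measurable fun a => G a (x a) := hG.eval.comp (measurable_id.prodMk hx)
  refine ⟨?_, ?_, fun h => ?_⟩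
  · have e : (fun p : A × X => (α • G p.1 + c p.1 • feature H (x p.1) : H) p.2)
        = fun p => α * G p.1 p.2 + c p.1 * ker H p.2 (x p.1) := by
      ext p
      simp [feature_apply]
    rw [e]
    have hk : Measurable fun p : A × X => ker H p.2 (x p.1) :=
      measurable_ker_comp hker measurable_snd (hx.comp measurable_fst)
    exact (hG.eval.const_mul α).add ((hc.comp measurable_fst).mul hk)
  · have e : (fun a => ‖α • G a + c a • feature H (x a)‖)
        = fun a => √(α ^ 2 * ‖G a‖ ^ 2 + 2 * (α * c a * G a (x a))
          + c a ^ 2 * ker H (x a) (x a)) := by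
      ext a
      rw [← Real.sqrt_sq (norm_nonneg (α • G a + c a • feature H (x a))), norm_add_sq_real,
        norm_smul, norm_smul, inner_smul_left, inner_smul_right, inner_feature, mul_pow, mul_pow,
        norm_feature_sq, Real.norm_eq_abs, Real.norm_eq_abs, sq_abs, sq_abs, conj_trivial,
        mul_assoc α]
    rw [e]
    have hk : Measurable fun a => ker H (x a) (x a) := measurable_ker_comp hker hx hx
    exact ((((hG.norm.pow_const 2).const_mul _).add
      (((hc.const_mul α).mul hGx).const_mul 2)).add ((hc.pow_const 2).mul hk)).sqrt
  · simp_rw [inner_add_left, inner_smul_left, real_inner_comm h, inner_feature, conj_trivial]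
    exact ((by simpa only [real_inner_comm h] using hG.inner h :
      Measurable fun a => ⟪h, G a⟫_ℝ).const_mul α).add
        (hc.mul ((measurable_coe hker h).comp hx))

theorem step (hker : Measurable fun p : X × X => ker H p.1 p.2) {φ : ℝ → ℝ}
    (hφ : Differentiable ℝ φ) {G : A → H} (hG : WeaklyMeasurable G) (lam η : ℝ)
    {z : A → X × ℤˣ} (hz : Measurable z) :
    WeaklyMeasurable fun a => G a - η • regStochGrad φ lam (G a) (z a) := by
  have hc : Measurable fun a => -(η * lossDeriv φ (G a (z a).1) (z a).2) :=
    (((measurable_lossDeriv hφ).comp ((hG.eval.comp (measurable_id.prodMk hz.fst)).prodMk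
      hz.snd)).const_mul η).neg
  have e : (fun a => G a - η • regStochGrad φ lam (G a) (z a)) = fun a =>
      (1 - η * lam) • G a
        + (-(η * lossDeriv φ (G a (z a).1) (z a).2)) • feature H (z a).1 := by
    ext1 a
    rw [regStochGrad, stochGrad]
    module
  rw [e]
  exact hG.smul_add_smul_feature hker _ hc hz.fst

omit [CompleteSpace H] in
theorem comp {B : Type*} [MeasurableSpace B] {G : A → H} (hG : WeaklyMeasurable G) {f : B → A}
    (hf : Measurable f) : WeaklyMeasurable fun b => G (f b) :=
  ⟨hG.eval.comp ((hf.comp measurable_fst).prodMk measurable_snd), hG.norm.comp hf,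
    fun h => (hG.inner h).comp hf⟩

omit [CompleteSpace H] in
theorem norm_sub {G : A → H} (hG : WeaklyMeasurable G) (h : H) :
    Measurable fun a => ‖G a - h‖ := by
  have e : (fun a => ‖G a - h‖) = fun a => √(‖G a‖ ^ 2 - 2 * ⟪G a, h⟫_ℝ + ‖h‖ ^ 2) := by
    ext a
    rw [← norm_sub_sq_real, Real.sqrt_sq (norm_nonneg _)]
  rw [e]
  exact (((hG.norm.pow_const 2).sub ((hG.inner h).const_mul 2)).add measurable_const).sqrt

end WeaklyMeasurable

theorem weaklyMeasurable_sgd (hker : Measurable fun p : X × X => ker H p.1 p.2) {φ : ℝ → ℝ}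
    (hφ : Differentiable ℝ φ) (lam γ : ℝ) (g₁ : H) (n : ℕ) :
    WeaklyMeasurable fun u : ℕ → X × ℤˣ => sgd φ lam γ g₁ u n := by
  induction n with
  | zero => exact .const hker g₁
  | succ n ih => exact ih.step hker hφ lam _ (measurable_pi_apply (n + 1))

omit [MeasurableSpace X] in
theorem sgd_congr (φ : ℝ → ℝ) (lam γ : ℝ) (g₁ : H) {u v : ℕ → X × ℤˣ} {n : ℕ}
    (h : ∀ i ≤ n, u i = v i) : sgd φ lam γ g₁ u n = sgd φ lam γ g₁ v n := by
  induction n with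
  | zero => rfl
  | succ n ih => rw [sgd, sgd, ih fun i hi => h i (hi.trans n.le_succ), h (n + 1) le_rfl]

end Measurability

/-! ### Exponential tail bounds for stochastic gradient descent -/

/-- Freezing the sequence at time `n` encodes the past as a full sequence, to which `sgd` applies;
it is independent of the next sample. -/
theorem map_stopped_prodMk_eq {Ω S : Type*} [MeasurableSpace Ω] [MeasurableSpace S]
    {P : Measure Ω} [IsProbabilityMeasure P] {Z : ℕ → Ω → S} (hZ : ∀ t, Measurable (Z t))
    (hind : iIndepFun Z P) (n : ℕ) :
    P.map (fun ω => (fun i => Z (min i n) ω, Z (n + 1) ω))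
      = (P.map fun ω i => Z (min i n) ω).prod (P.map (Z (n + 1))) := by
  have h := hind.indepFun_finset (Finset.range (n + 1)) {n + 1} (by simp) hZ
  have hf : Measurable fun (w : Finset.range (n + 1) → S) (i : ℕ) =>
      w ⟨min i n, by simp⟩ :=
    measurable_pi_lambda _ fun i => measurable_pi_apply _
  have hg : Measurable fun w : ({n + 1} : Finset ℕ) → S => w ⟨n + 1, by simp⟩ :=
    measurable_pi_apply _
  have h2 := h.comp hf hg
  exact (indepFun_iff_map_prod_eq_prod_map_map
    (measurable_pi_lambda _ fun i => hZ _).aemeasurable (hZ _).aemeasurable).1 h2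

section Tail

variable {X : Type*} [MeasurableSpace X] {H : Type*} [NormedAddCommGroup H]
  [InnerProductSpace ℝ H] [CompleteSpace H] [RKHS ℝ H X ℝ]
  {φ : ℝ → ℝ} {ρ : Measure (X × ℤˣ)} [IsProbabilityMeasure ρ] {M L R lam γ : ℝ}
  {Ω : Type*} [MeasurableSpace Ω] {P : Measure Ω} [IsProbabilityMeasure P] {Z : ℕ → Ω → X × ℤˣ}

theorem three_le_of_stepSize_le (hlam : 0 < lam) (hγ : 0 < γ)
    (h : stepSize lam γ 1 ≤ 1 / (2 * lam)) : 3 ≤ γ := by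
  rw [stepSize, div_le_div_iff₀ (by positivity) (by positivity)] at h
  push_cast at h
  have : lam * 4 ≤ lam * (γ + 1) := by linarith
  linarith [le_of_mul_le_mul_left this hlam]

theorem stepSize_succ_le (hlam : 0 < lam) (hγ : 0 < γ) (n : ℕ) :
    stepSize lam γ (n + 1) ≤ stepSize lam γ 1 := by
  rw [stepSize, stepSize]
  push_cast
  gcongr
  linarith [(n.cast_nonneg : (0 : ℝ) ≤ n)]

/-- Each step replaces `θ` by `θ(1 - ηλ)`, so the induction runs over all `θ` at once. The bias
contracts at least as fast as `γ/(γ + n)`, and the variance proxy obeys `V_{n+1} = (1 - ηλ)² V_n +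
K²/(γ + n + 1)²` with `K = 4MR/λ`, which keeps it below `K² n/(γ + n)²`. -/
theorem SmoothProblem.lintegral_cosh_sgd_le (hP : SmoothProblem H φ ρ M L R) (hlam : 0 < lam)
    (hγ : 0 < γ) (hη : stepSize lam γ 1 ≤ min (1 / (L + lam)) (1 / (2 * lam))) {gl : H}
    (hgl : gradient (riskH φ ρ) gl + lam • gl = 0) (g₁ : H) (hZ : ∀ t, Measurable (Z t))
    (hlaw : ∀ t, P.map (Z t) = ρ) (hind : iIndepFun Z P) (n : ℕ) :
    ∀ θ : ℝ, 0 ≤ θ →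
      ∫⁻ ω, ENNReal.ofReal
          (Real.cosh (θ * ‖sgd φ lam γ g₁ (fun t => Z t ω) n - gl‖)) ∂P
        ≤ ENNReal.ofReal (Real.cosh (θ * (γ / (γ + n) * ‖g₁ - gl‖))
          * Real.exp (θ ^ 2 * ((4 * M * R / lam) ^ 2 * n / (γ + n) ^ 2) / 2)) := by
  -- Keeps the contraction factor `(γ + n - 1)/(γ + n + 1)` nonnegative from `n = 0` on.
  have h3 := three_le_of_stepSize_le hlam hγ (hη.trans (min_le_right _ _))
  induction n with
  | zero =>
    intro θ _
    simp [sgd, hγ.ne']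
  | succ n ih =>
    intro θ hθ
    set η := stepSize lam γ (n + 1) with hηdef
    have hηlam : η * lam = 2 / (γ + n + 1) := by
      rw [hηdef, stepSize]; push_cast; field_simp; ring
    have hη0 : 0 ≤ η := by rw [hηdef, stepSize]; positivity
    have hηL : η ≤ 1 / (L + lam) :=
      (stepSize_succ_le hlam hγ n).trans (hη.trans (min_le_left _ _))
    have hn : (0 : ℝ) ≤ n := n.cast_nonneg
    have hfac : 1 - η * lam = (γ + n - 1) / (γ + n + 1) := by
      rw [hηlam]; field_simp; ring
    have hfac0 : 0 ≤ 1 - η * lam := by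
      rw [hfac]; exact div_nonneg (by linarith) (by linarith)
    set U : Ω → ℕ → X × ℤˣ := fun ω i => Z (min i n) ω with hU
    have hUm : Measurable U := measurable_pi_lambda _ fun i => hZ _
    have hsgdU : ∀ ω, sgd φ lam γ g₁ (fun t => Z t ω) n = sgd φ lam γ g₁ (U ω) n := fun ω =>
      sgd_congr φ lam γ g₁ fun i hi => by rw [hU]; simp only [min_eq_left hi]
    set Φ : (ℕ → X × ℤˣ) × (X × ℤˣ) → ENNReal := fun p => ENNReal.ofReal (Real.cosh
      (θ * ‖sgd φ lam γ g₁ p.1 n - η • regStochGrad φ lam (sgd φ lam γ g₁ p.1 n) p.2 - gl‖))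
      with hΦ
    have hsgdm := weaklyMeasurable_sgd hP.measurable_ker hP.differentiable lam γ g₁ n
    have hΦm : Measurable Φ :=
      (Real.measurable_cosh.comp ((((hsgdm.comp measurable_fst).step hP.measurable_ker
        hP.differentiable lam η measurable_snd).norm_sub gl).const_mul θ)).ennreal_ofReal
    set E := Real.exp (θ ^ 2 * η ^ 2 * (2 * M * R) ^ 2 / 2) with hE
    calc ∫⁻ ω, ENNReal.ofReal
          (Real.cosh (θ * ‖sgd φ lam γ g₁ (fun t => Z t ω) (n + 1) - gl‖)) ∂P
        = ∫⁻ ω, Φ (U ω, Z (n + 1) ω) ∂P := by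
          refine lintegral_congr fun ω => ?_
          rw [sgd, hsgdU]
      _ = ∫⁻ p, Φ p ∂((P.map U).prod ρ) := by
          rw [← hlaw (n + 1), ← map_stopped_prodMk_eq hZ hind n,
            lintegral_map hΦm (hUm.prodMk (hZ _))]
      _ = ∫⁻ u, ∫⁻ z, Φ (u, z) ∂ρ ∂(P.map U) := lintegral_prod _ hΦm.aemeasurable
      _ ≤ ∫⁻ u, ENNReal.ofReal (Real.cosh (θ * ((1 - η * lam) * ‖sgd φ lam γ g₁ u n - gl‖)) * E)
            ∂(P.map U) := by
          refine lintegral_mono fun u => ?_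
          exact hP.lintegral_cosh_step_le hlam hη0 hηL hθ hgl (sgd φ lam γ g₁ u n)
      _ = ∫⁻ ω, ENNReal.ofReal (Real.cosh
            (θ * (1 - η * lam) * ‖sgd φ lam γ g₁ (fun t => Z t ω) n - gl‖)) * ENNReal.ofReal E
            ∂P := by
          rw [lintegral_map _ hUm]
          · refine lintegral_congr fun ω => ?_
            rw [hsgdU, ENNReal.ofReal_mul (Real.cosh_pos _).le, mul_assoc θ]
          · exact ((Real.measurable_cosh.comp (((hsgdm.norm_sub gl).const_mul _).const_mul
              θ)).mul_const E).ennreal_ofReal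
      _ ≤ ENNReal.ofReal (Real.cosh (θ * (1 - η * lam) * (γ / (γ + n) * ‖g₁ - gl‖))
            * Real.exp ((θ * (1 - η * lam)) ^ 2 * ((4 * M * R / lam) ^ 2 * n / (γ + n) ^ 2) / 2))
            * ENNReal.ofReal E := by
          rw [lintegral_mul_const' _ _ ENNReal.ofReal_ne_top]
          gcongr
          exact ih _ (by positivity)
      _ ≤ _ := by
          rw [← ENNReal.ofReal_mul (by positivity), mul_assoc, hE, ← Real.exp_add]
          refine ENNReal.ofReal_le_ofReal (mul_le_mul ?_ (Real.exp_le_exp.2 ?_)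
            (Real.exp_pos _).le (Real.cosh_pos _).le)
          · rw [Real.cosh_le_cosh]
            refine abs_le_abs_of_nonneg (by positivity) ?_
            rw [mul_assoc, ← mul_assoc (1 - η * lam)]
            refine mul_le_mul_of_nonneg_left (mul_le_mul_of_nonneg_right ?_ (norm_nonneg _)) hθ
            rw [hfac]
            push_cast
            rw [div_mul_div_comm, div_le_div_iff₀ (by positivity) (by positivity)]
            have : 0 ≤ γ * (γ + n + 1) := by positivity
            nlinarith
          · have hη2 : η * (2 * M * R) = (4 * M * R / lam) / (γ + n + 1) := by
              rw [hηdef, stepSize]; push_cast; field_simp; ring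
            have e1 : θ ^ 2 * η ^ 2 * (2 * M * R) ^ 2
                = θ ^ 2 * ((4 * M * R / lam) ^ 2 / (γ + n + 1) ^ 2) := by
              rw [mul_assoc, ← mul_pow, hη2, div_pow]
            rw [e1, hfac]
            push_cast
            set K := 4 * M * R / lam
            have e2 : ((γ + n - 1) / (γ + n + 1)) ^ 2 * (K ^ 2 * n / (γ + n) ^ 2)
                ≤ K ^ 2 * n / (γ + n + 1) ^ 2 := by
              have : ((γ + n - 1) / (γ + n)) ^ 2 ≤ 1 := by
                apply pow_le_one₀ (div_nonneg (by linarith) (by linarith))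
                rw [div_le_one (by linarith)]; linarith
              calc ((γ + n - 1) / (γ + n + 1)) ^ 2 * (K ^ 2 * n / (γ + n) ^ 2)
                  = ((γ + n - 1) / (γ + n)) ^ 2 * (K ^ 2 * n / (γ + n + 1) ^ 2) := by
                    simp only [div_pow]; ring
                _ ≤ 1 * (K ^ 2 * n / (γ + n + 1) ^ 2) := by gcongr
                _ = _ := one_mul _
            have e3 : θ ^ 2 * (((γ + n - 1) / (γ + n + 1)) ^ 2 * (K ^ 2 * n / (γ + n) ^ 2))
                ≤ θ ^ 2 * (K ^ 2 * n / (γ + n + 1) ^ 2) := by gcongr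
            have e4 : K ^ 2 * (n + 1) / (γ + (n + 1)) ^ 2
                = K ^ 2 * n / (γ + n + 1) ^ 2 + K ^ 2 / (γ + n + 1) ^ 2 := by
              rw [← add_div, ← add_assoc]; ring
            rw [e4, mul_pow]
            linarith

theorem SmoothProblem.measureReal_norm_sgd_sub_ge_le (hP : SmoothProblem H φ ρ M L R)
    (hlam : 0 < lam) (hγ : 0 < γ)
    (hη : stepSize lam γ 1 ≤ min (1 / (L + lam)) (1 / (2 * lam))) {gl : H}
    (hgl : gradient (riskH φ ρ) gl + lam • gl = 0) (g₁ : H) (hZ : ∀ t, Measurable (Z t))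
    (hlaw : ∀ t, P.map (Z t) = ρ) (hind : iIndepFun Z P) (T : ℕ) {s : ℝ} (hs : 0 < s)
    (hinit : γ / (γ + T) * ‖g₁ - gl‖ ≤ s) :
    P.real {ω | 2 * s ≤ ‖sgd φ lam γ g₁ (fun t => Z t ω) T - gl‖}
      ≤ 2 * Real.exp (-(s ^ 2 * lam ^ 2 * (γ + T) / (32 * M ^ 2 * R ^ 2))) := by
  have hM := hP.M_pos
  have hR := hP.R_pos
  set V := (4 * M * R / lam) ^ 2 / (γ + T) with hV
  have hV0 : 0 < V := by positivity
  -- Half of the threshold `2s` pays for the initial bias; this `θ` minimizes the remaining exponent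
  -- `-θs + θ²V/2`, with value `-s²/(2V)`.
  set θ := s / V with hθ
  have hθ0 : 0 < θ := by positivity
  have hθV : θ * V = s := div_mul_cancel₀ _ hV0.ne'
  have hT : (0 : ℝ) ≤ T := T.cast_nonneg
  have hVT : (4 * M * R / lam) ^ 2 * T / (γ + T) ^ 2 ≤ V := by
    rw [hV, div_le_div_iff₀ (by positivity) (by positivity)]
    have : 0 ≤ (4 * M * R / lam) ^ 2 * (γ + T) * γ := by positivity
    nlinarith
  have hbound := hP.lintegral_cosh_sgd_le hlam hγ hη hgl g₁ hZ hlaw hind T θ hθ0.le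
  have hsgdm := ((weaklyMeasurable_sgd hP.measurable_ker hP.differentiable lam γ g₁ T).comp
    (measurable_pi_lambda (fun ω t => Z t ω) hZ)).norm_sub gl
  have hmarkov := mul_meas_ge_le_lintegral (μ := P)
    (Real.measurable_cosh.comp (hsgdm.const_mul θ)).ennreal_ofReal
    (ENNReal.ofReal (Real.cosh (θ * (2 * s))))
  have hsub : {ω | 2 * s ≤ ‖sgd φ lam γ g₁ (fun t => Z t ω) T - gl‖}
      ⊆ {ω | ENNReal.ofReal (Real.cosh (θ * (2 * s))) ≤ ENNReal.ofReal
        (Real.cosh (θ * ‖sgd φ lam γ g₁ (fun t => Z t ω) T - gl‖))} := by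
    intro ω hω
    refine ENNReal.ofReal_le_ofReal (Real.cosh_le_cosh.2 (abs_le_abs_of_nonneg (by positivity) ?_))
    exact mul_le_mul_of_nonneg_left hω hθ0.le
  have hfinal : ENNReal.ofReal (Real.cosh (θ * (2 * s)))
      * P {ω | 2 * s ≤ ‖sgd φ lam γ g₁ (fun t => Z t ω) T - gl‖}
      ≤ ENNReal.ofReal (Real.cosh (θ * (γ / (γ + T) * ‖g₁ - gl‖))
          * Real.exp (θ ^ 2 * ((4 * M * R / lam) ^ 2 * T / (γ + T) ^ 2) / 2)) :=
    (mul_le_mul_right (measure_mono hsub) _).trans (hmarkov.trans hbound)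
  have hreal := ENNReal.toReal_mono ENNReal.ofReal_ne_top hfinal
  rw [ENNReal.toReal_mul, ENNReal.toReal_ofReal (Real.cosh_pos _).le,
    ENNReal.toReal_ofReal (by positivity), ← measureReal_def] at hreal
  set p := P.real {ω | 2 * s ≤ ‖sgd φ lam γ g₁ (fun t => Z t ω) T - gl‖}
  have hp : 0 ≤ p := measureReal_nonneg
  have h1 : Real.cosh (θ * (γ / (γ + T) * ‖g₁ - gl‖)) ≤ Real.exp (θ * s) := by
    have h : Real.cosh (θ * (γ / (γ + T) * ‖g₁ - gl‖)) ≤ Real.cosh (θ * s) :=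
      Real.cosh_le_cosh.2 (abs_le_abs_of_nonneg (by positivity) (by gcongr))
    refine h.trans ?_
    rw [Real.cosh_eq]
    have : Real.exp (-(θ * s)) ≤ Real.exp (θ * s) :=
      Real.exp_le_exp.2 (by linarith [mul_pos hθ0 hs])
    linarith
  have h2 : Real.exp (θ ^ 2 * ((4 * M * R / lam) ^ 2 * T / (γ + T) ^ 2) / 2)
      ≤ Real.exp (θ * s / 2) := by
    rw [Real.exp_le_exp]
    calc θ ^ 2 * ((4 * M * R / lam) ^ 2 * T / (γ + T) ^ 2) / 2 ≤ θ ^ 2 * V / 2 := by gcongr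
      _ = θ * s / 2 := by rw [← hθV]; ring
  have h3 : Real.exp (θ * (2 * s)) / 2 ≤ Real.cosh (θ * (2 * s)) := by
    rw [Real.cosh_eq]
    linarith [Real.exp_pos (-(θ * (2 * s)))]
  have h4 : Real.exp (θ * (2 * s)) / 2 * p ≤ Real.exp (θ * s) * Real.exp (θ * s / 2) :=
    (mul_le_mul_of_nonneg_right h3 hp).trans (hreal.trans (mul_le_mul h1 h2
      (Real.exp_pos _).le (Real.exp_pos _).le))
  have h5 : p ≤ 2 * Real.exp (-(θ * s / 2)) := by
    have e : Real.exp (θ * s) * Real.exp (θ * s / 2)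
        = Real.exp (θ * (2 * s)) / 2 * (2 * Real.exp (-(θ * s / 2))) := by
      rw [← Real.exp_add, show θ * s + θ * s / 2 = θ * (2 * s) + -(θ * s / 2) by ring,
        Real.exp_add]
      ring
    rw [e] at h4
    exact le_of_mul_le_mul_left h4 (by positivity)
  refine h5.trans (le_of_eq ?_)
  congr 3
  rw [hθ, hV]
  field_simp
  ring

end Tail

end KernelSGD

namespace KernelSGD

/-! ### The link function -/

section Link

variable {φ : ℝ → ℝ} {μ δ : ℝ}

theorem isCondMin_link (hlink : LinkWellDefined φ) (hμ : μ ∈ Ioo (0 : ℝ) 1) :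
    IsCondMin φ μ (link φ μ) :=
  Classical.epsilon_spec (hlink μ hμ).exists

theorem condRisk_one_sub_neg (φ : ℝ → ℝ) (μ h : ℝ) :
    condRisk φ (1 - μ) (-h) = condRisk φ μ h := by
  rw [condRisk, condRisk, neg_neg]; ring

/-- Exchanging the labels reflects the conditional risk, and minimizers are unique. Hence both
entries of the maximum in `margin` coincide. -/
theorem link_one_sub (hlink : LinkWellDefined φ) (hμ : μ ∈ Ioo (0 : ℝ) 1) :
    link φ (1 - μ) = -link φ μ := by
  have hμ' : 1 - μ ∈ Ioo (0 : ℝ) 1 := ⟨by linarith [hμ.2], by linarith [hμ.1]⟩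
  refine (hlink _ hμ').unique (isCondMin_link hlink hμ') fun h' => ?_
  rw [condRisk_one_sub_neg, ← neg_neg h', condRisk_one_sub_neg]
  exact isCondMin_link hlink hμ _

theorem link_half_add_pos (hδ : δ ∈ Ioo (0 : ℝ) (1 / 2))
    (hsign : ∀ μ ∈ Ioo (0 : ℝ) 1, Real.sign (μ - 1 / 2) = Real.sign (link φ μ)) :
    0 < link φ (1 / 2 + δ) := by
  have h := hsign (1 / 2 + δ) ⟨by linarith [hδ.1], by linarith [hδ.2]⟩
  rw [add_sub_cancel_left, Real.sign_of_pos hδ.1] at h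
  rcases lt_trichotomy (link φ (1 / 2 + δ)) 0 with h0 | h0 | h0
  · rw [Real.sign_of_neg h0] at h; norm_num at h
  · rw [h0, Real.sign_zero] at h; norm_num at h
  · exact h0

theorem margin_eq (hlink : LinkWellDefined φ) (hδ : δ ∈ Ioo (0 : ℝ) (1 / 2))
    (hsign : ∀ μ ∈ Ioo (0 : ℝ) 1, Real.sign (μ - 1 / 2) = Real.sign (link φ μ)) :
    margin φ δ = link φ (1 / 2 + δ) := by
  have h := link_one_sub hlink (μ := 1 / 2 + δ) ⟨by linarith [hδ.1], by linarith [hδ.2]⟩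
  rw [show (1 : ℝ) - (1 / 2 + δ) = 1 / 2 - δ by ring] at h
  rw [margin, h, abs_neg, abs_of_pos (link_half_add_pos hδ hsign), max_self]

/-- Functions within the margin of the link of the conditional probability have the sign of the
Bayes classifier. -/
theorem sign_eq_of_abs_sub_link_lt (hlink : LinkWellDefined φ) (hδ : δ ∈ Ioo (0 : ℝ) (1 / 2))
    (hmono : MonotoneOn (link φ) (Ioo 0 1))
    (hsign : ∀ μ ∈ Ioo (0 : ℝ) 1, Real.sign (μ - 1 / 2) = Real.sign (link φ μ))
    (hμ : μ ∈ Ioo (0 : ℝ) 1) (hδμ : δ < |μ - 1 / 2|) {h : ℝ} (hh : |h - link φ μ| < margin φ δ) :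
    Real.sign h = Real.sign (2 * μ - 1) := by
  rw [margin_eq hlink hδ hsign] at hh
  obtain ⟨h1, h2⟩ := abs_lt.1 hh
  have hpl : 1 / 2 + δ ∈ Ioo (0 : ℝ) 1 := ⟨by linarith [hδ.1], by linarith [hδ.2]⟩
  have hmi : 1 - (1 / 2 + δ) ∈ Ioo (0 : ℝ) 1 := ⟨by linarith [hδ.2], by linarith [hδ.1]⟩
  have hδ0 := hδ.1
  rcases lt_abs.1 hδμ with hlt | hlt
  · have := hmono hpl hμ (by linarith)
    rw [Real.sign_of_pos (by linarith), Real.sign_of_pos (by linarith)]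
  · have := hmono hμ hmi (by linarith)
    rw [link_one_sub hlink hpl] at this
    rw [Real.sign_of_neg (by linarith), Real.sign_of_neg (by linarith)]

end Link

/-! ### The Bayes rule -/

section Bayes

variable {X : Type*} [MeasurableSpace X] {φ : ℝ → ℝ} {ρ : Measure (X × ℤˣ)}

theorem measurable_condProb [IsFiniteMeasure ρ] : Measurable (condProb ρ) :=
  (Kernel.measurable_coe ρ.condKernel (measurableSet_singleton 1)).ennreal_toReal

variable [IsProbabilityMeasure ρ]

theorem lintegral_loss_eq (hφ : Differentiable ℝ φ) (hnonneg : ∀ v, 0 ≤ φ v) {f : X → ℝ}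
    (hf : Measurable f) :
    ∫⁻ z, ENNReal.ofReal (loss φ (f z.1) z.2) ∂ρ
      = ∫⁻ x, ENNReal.ofReal (condRisk φ (condProb ρ x) (f x)) ∂ρ.fst := by
  have hm : Measurable fun z : X × ℤˣ => ENNReal.ofReal (loss φ (f z.1) z.2) :=
    ((measurable_loss hφ).comp ((hf.comp measurable_fst).prodMk measurable_snd)).ennreal_ofReal
  rw [← Measure.lintegral_condKernel hm]
  refine lintegral_congr fun x => ?_
  have hneg : ρ.condKernel x {-1} = ENNReal.ofReal (1 - condProb ρ x) := by
    have hc : ({-1} : Set ℤˣ) = {1}ᶜ := by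
      ext y
      rcases Int.units_eq_one_or y with rfl | rfl <;> simp
    rw [hc, ← ofReal_measureReal, probReal_compl_eq_one_sub (measurableSet_singleton _), condProb]
  have hloss : ∀ ζ y, 0 ≤ loss φ ζ y := fun ζ y => hnonneg _
  have h0 : 0 ≤ condProb ρ x := measureReal_nonneg
  have h1 : condProb ρ x ≤ 1 := measureReal_le_one
  rw [lintegral_fintype]
  have huniv : (Finset.univ : Finset ℤˣ) = {1, -1} := rfl
  rw [huniv, Finset.sum_pair (by decide), hneg, ← ofReal_measureReal (s := {1}), ← condProb,
    ← ENNReal.ofReal_mul (hloss _ _), ← ENNReal.ofReal_mul (hloss _ _),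
    ← ENNReal.ofReal_add (mul_nonneg (hloss _ _) h0) (mul_nonneg (hloss _ _) (by linarith))]
  congr 1
  simp only [loss, lab, condRisk, Units.val_one, Units.val_neg, Int.cast_one, Int.cast_neg, one_mul,
    neg_mul]
  ring

theorem exists_measurable_link_condProb (hdiff : DifferentiableOn ℝ (link φ) (Ioo 0 1))
    (hprob : ∀ᵐ x ∂ρ.fst, condProb ρ x ∈ Ioo (0 : ℝ) 1) :
    ∃ f : X → ℝ, Measurable f ∧ ∀ᵐ x ∂ρ.fst, f x = link φ (condProb ρ x) := by
  classical
  refine ⟨fun x => (Ioo 0 1).piecewise (link φ) (fun _ => 0) (condProb ρ x), ?_, ?_⟩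
  · exact (hdiff.continuousOn.measurable_piecewise continuousOn_const measurableSet_Ioo).comp
      measurable_condProb
  · filter_upwards [hprob] with x hx
    exact piecewise_eq_of_mem _ _ _ hx

/-- A Bayes rule that is unique up to null sets is the link of the conditional probability. -/
theorem ae_eq_link_of_isBayesRule (hφ : Differentiable ℝ φ) (hnonneg : ∀ v, 0 ≤ φ v)
    (hlink : LinkWellDefined φ) (hdiff : DifferentiableOn ℝ (link φ) (Ioo 0 1))
    (hprob : ∀ᵐ x ∂ρ.fst, condProb ρ x ∈ Ioo (0 : ℝ) 1) {g : X → ℝ} (hg : IsBayesRule φ ρ g)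
    (huniq : ∀ f : X → ℝ, IsBayesRule φ ρ f → f =ᵐ[ρ.fst] g) :
    ∀ᵐ x ∂ρ.fst, g x = link φ (condProb ρ x) := by
  obtain ⟨f, hf, hfl⟩ := exists_measurable_link_condProb hdiff hprob
  have hmeas : ∀ {f : X → ℝ}, Measurable f →
      AEStronglyMeasurable (fun z : X × ℤˣ => loss φ (f z.1) z.2) ρ := fun hf =>
    ((measurable_loss hφ).comp ((hf.comp measurable_fst).prodMk
      measurable_snd)).aestronglyMeasurable
  have hpos : ∀ f : X → ℝ, ∀ᵐ z : X × ℤˣ ∂ρ, 0 ≤ loss φ (f z.1) z.2 := fun f =>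
    ae_of_all _ fun z => hnonneg _
  -- The comparison is made in `ENNReal` because finiteness of the risk of `f` is itself a
  -- consequence of it.
  have hle : ∫⁻ z, ENNReal.ofReal (loss φ (f z.1) z.2) ∂ρ
      ≤ ∫⁻ z, ENNReal.ofReal (loss φ (g z.1) z.2) ∂ρ := by
    rw [lintegral_loss_eq hφ hnonneg hf, lintegral_loss_eq hφ hnonneg hg.1]
    refine lintegral_mono_ae ?_
    filter_upwards [hfl, hprob] with x hx hx'
    rw [hx]
    exact ENNReal.ofReal_le_ofReal (isCondMin_link hlink hx' _)
  have hgfin : ∫⁻ z, ENNReal.ofReal (loss φ (g z.1) z.2) ∂ρ ≠ ⊤ :=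
    ((hasFiniteIntegral_iff_ofReal (hpos g)).1 hg.2.1.hasFiniteIntegral).ne
  have hfB : IsBayesRule φ ρ f := by
    refine ⟨hf, ⟨hmeas hf, (hasFiniteIntegral_iff_ofReal (hpos f)).2
      (hle.trans_lt hgfin.lt_top)⟩, fun f' hf' hfin => le_trans ?_ (hg.2.2 f' hf' hfin)⟩
    rw [risk, risk, integral_eq_lintegral_of_nonneg_ae (hpos f) (hmeas hf),
      integral_eq_lintegral_of_nonneg_ae (hpos g) (hmeas hg.1)]
    exact ENNReal.toReal_mono hgfin hle
  filter_upwards [huniq f hfB, hfl] with x h1 h2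
  rw [← h1, h2]

end Bayes

/-! ### The classification error -/

section Classification

variable {X : Type*} [MeasurableSpace X] {ρ : Measure (X × ℤˣ)}

theorem zeroOne_nonneg (a b : ℝ) : 0 ≤ zeroOne a b := by
  rw [zeroOne]; split_ifs <;> norm_num

theorem zeroOne_le_one (a b : ℝ) : zeroOne a b ≤ 1 := by
  rw [zeroOne]; split_ifs <;> norm_num

theorem measurable_real_sign : Measurable Real.sign :=
  Measurable.ite measurableSet_Iio measurable_const
    (Measurable.ite measurableSet_Ioi measurable_const measurable_const)

theorem measurable_zeroOne {A : Type*} [MeasurableSpace A] {f g : A → ℝ} (hf : Measurable f)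
    (hg : Measurable g) : Measurable fun a => zeroOne (f a) (g a) := by
  classical
  simp only [zeroOne]
  convert Measurable.ite (measurableSet_eq_fun hf hg) (measurable_const (a := (0 : ℝ)))
    (measurable_const (a := (1 : ℝ))) using 1

theorem classError_congr {f g : X → ℝ} (h : ∀ᵐ x ∂ρ.fst, Real.sign (f x) = Real.sign (g x)) :
    classError ρ f = classError ρ g := by
  refine integral_congr_ae ?_
  filter_upwards [ae_of_ae_map measurable_fst.aemeasurable h] with z hz
  rw [hz]

theorem classError_nonneg (f : X → ℝ) : 0 ≤ classError ρ f :=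
  integral_nonneg fun _ => zeroOne_nonneg _ _

theorem classError_le_one [IsProbabilityMeasure ρ] (f : X → ℝ) : classError ρ f ≤ 1 := by
  have := norm_integral_le_of_norm_le_const (μ := ρ) (C := 1)
    (f := fun z : X × ℤˣ => zeroOne (Real.sign (f z.1)) (lab z.2)) (ae_of_all _ fun z => by
      rw [Real.norm_eq_abs, abs_of_nonneg (zeroOne_nonneg _ _)]; exact zeroOne_le_one _ _)
  simp only [probReal_univ, mul_one] at this
  exact (le_abs_self _).trans this

theorem measurable_classError [SFinite ρ] {A : Type*} [MeasurableSpace A] {G : A → X → ℝ}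
    (hG : Measurable fun p : A × X => G p.1 p.2) : Measurable fun a => classError ρ (G a) := by
  have hm : Measurable fun p : A × (X × ℤˣ) =>
      zeroOne (Real.sign (G p.1 p.2.1)) (lab p.2.2) :=
    measurable_zeroOne (measurable_real_sign.comp (hG.comp
      (measurable_fst.prodMk measurable_snd.fst))) (measurable_lab.comp measurable_snd.snd)
  exact (hm.stronglyMeasurable.integral_prod_right (ν := ρ)).measurable

end Classification

/-! ### From the tail bound to the expected excess error -/

section Rate

variable {X : Type*} [MeasurableSpace X] {H : Type*} [NormedAddCommGroup H]
  [InnerProductSpace ℝ H] [CompleteSpace H] [RKHS ℝ H X ℝ]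
  {φ : ℝ → ℝ} {ρ : Measure (X × ℤˣ)} [IsProbabilityMeasure ρ] {M L R lam γ : ℝ}
  {Ω : Type*} [MeasurableSpace Ω] {P : Measure Ω} [IsProbabilityMeasure P] {Z : ℕ → Ω → X × ℤˣ}

theorem SmoothProblem.initial_error_le (hP : SmoothProblem H φ ρ M L R) (hlam : 0 < lam)
    (hγ : 0 < γ) {σ m T : ℝ} (hm : 0 < m) (hT : 0 ≤ T) {g₁ gl : H}
    (hgl : gradient (riskH φ ρ) gl + lam • gl = 0)
    (hTle : 32 * R ^ 2 * nu φ ρ lam γ L σ g₁ gl / (m ^ 2 * lam) - γ ≤ T) :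
    γ / (γ + T) * ‖g₁ - gl‖ ≤ m / (4 * R) := by
  have hR := hP.R_pos
  set D := ‖g₁ - gl‖
  have hgrow := regularized_quadratic_growth hP.gradient_tangent_le hgl g₁
  -- Strong convexity turns the initial risk gap, the second entry of the maximum, into a bound on
  -- the initial distance.
  have hnu : (1 + γ) * (lam / 2 * D ^ 2) ≤ nu φ ρ lam γ L σ g₁ gl := by
    refine le_trans ?_ (le_max_right _ _)
    refine mul_le_mul_of_nonneg_left ?_ (by linarith)
    rw [regRisk, regRisk]
    linarith
  have h1 : 32 * R ^ 2 * nu φ ρ lam γ L σ g₁ gl ≤ (γ + T) * (m ^ 2 * lam) := by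
    rw [← div_le_iff₀ (by positivity)]; linarith
  have h2 : 32 * R ^ 2 * ((1 + γ) * (lam / 2 * D ^ 2)) ≤ (γ + T) * (m ^ 2 * lam) :=
    (mul_le_mul_of_nonneg_left hnu (by positivity)).trans h1
  have h3 : 16 * R ^ 2 * (1 + γ) * D ^ 2 ≤ (γ + T) * m ^ 2 := by
    refine le_of_mul_le_mul_right ?_ hlam
    linarith
  refine le_of_sq_le_sq ?_ (by positivity)
  rw [div_mul_eq_mul_div, div_pow, div_pow, div_le_div_iff₀ (by positivity) (by positivity)]
  calc (γ * D) ^ 2 * (4 * R) ^ 2 = γ ^ 2 * (16 * R ^ 2 * D ^ 2) := by ring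
    _ ≤ (γ * (1 + γ)) * (16 * R ^ 2 * D ^ 2) := by gcongr; nlinarith
    _ = γ * (16 * R ^ 2 * (1 + γ) * D ^ 2) := by ring
    _ ≤ γ * ((γ + T) * m ^ 2) := by gcongr
    _ ≤ (γ + T) * ((γ + T) * m ^ 2) := by gcongr; linarith
    _ = m ^ 2 * (γ + T) ^ 2 := by ring

theorem SmoothProblem.integral_classError_sgd_le (hP : SmoothProblem H φ ρ M L R)
    (hlam : 0 < lam) (hγ : 0 < γ)
    (hη : stepSize lam γ 1 ≤ min (1 / (L + lam)) (1 / (2 * lam))) {gl : H}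
    (hgl : gradient (riskH φ ρ) gl + lam • gl = 0) {m : ℝ} (hm : 0 < m) {f : X → ℝ}
    (hclass : ∀ g : H, ‖g - gl‖ < m / (2 * R) → classError ρ g = classError ρ f)
    (g₁ : H) (hZ : ∀ t, Measurable (Z t)) (hlaw : ∀ t, P.map (Z t) = ρ) (hind : iIndepFun Z P)
    (T : ℕ) (hinit : γ / (γ + T) * ‖g₁ - gl‖ ≤ m / (4 * R)) :
    Integrable (fun ω => classError ρ (sgd φ lam γ g₁ (fun t => Z t ω) T : H)) P ∧
    ∫ ω, (classError ρ (sgd φ lam γ g₁ (fun t => Z t ω) T : H) - classError ρ f) ∂P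
      ≤ 2 * Real.exp (-(m ^ 2 * lam ^ 2 * (γ + T) / (2 ^ 9 * M ^ 2 * R ^ 4))) := by
  have hR := hP.R_pos
  have hM := hP.M_pos
  have hW := (weaklyMeasurable_sgd hP.measurable_ker hP.differentiable lam γ g₁ T).comp
    (measurable_pi_lambda (fun ω t => Z t ω) hZ)
  have hint : Integrable (fun ω => classError ρ (sgd φ lam γ g₁ (fun t => Z t ω) T : H)) P :=
    Integrable.of_bound (C := 1) (measurable_classError hW.eval).aestronglyMeasurable
      (ae_of_all _ fun ω => by
        rw [Real.norm_eq_abs, abs_of_nonneg (classError_nonneg _)]; exact classError_le_one _)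
  refine ⟨hint, ?_⟩
  have htail := hP.measureReal_norm_sgd_sub_ge_le hlam hγ hη hgl g₁ hZ hlaw hind T
    (s := m / (4 * R)) (by positivity) hinit
  set B : Set Ω := {ω | 2 * (m / (4 * R)) ≤ ‖sgd φ lam γ g₁ (fun t => Z t ω) T - gl‖} with hB
  have hBm : MeasurableSet B := measurableSet_le measurable_const (hW.norm_sub gl)
  have hs : 2 * (m / (4 * R)) = m / (2 * R) := by field_simp; norm_num
  calc ∫ ω, (classError ρ (sgd φ lam γ g₁ (fun t => Z t ω) T : H) - classError ρ f) ∂P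
      ≤ ∫ ω, B.indicator (fun _ => (1 : ℝ)) ω ∂P := by
        refine integral_mono (hint.sub (integrable_const _))
          ((integrable_const _).indicator hBm) fun ω => ?_
        by_cases hω : ω ∈ B
        · rw [indicator_of_mem hω]
          have h1 := classError_le_one (ρ := ρ) (sgd φ lam γ g₁ (fun t => Z t ω) T : H)
          have h2 := classError_nonneg (ρ := ρ) f
          linarith
        · rw [indicator_of_notMem hω]
          rw [hB, mem_ofPred_eq, not_le, hs] at hω
          exact (sub_eq_zero.2 (hclass _ hω)).le
    _ = P.real B := by rw [integral_indicator_const _ hBm, smul_eq_mul, mul_one]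
    _ ≤ _ := htail
    _ = _ := by
        congr 3
        field_simp
        norm_num

end Rate

end KernelSGD

/-! ### The main theorem -/

theorem theorem1
    {X : Type*} [TopologicalSpace X] [MeasurableSpace X] [OpensMeasurableSpace X]
    (ρ : Measure (X × ℤˣ)) [IsProbabilityMeasure ρ]
    (H : Type*) [NormedAddCommGroup H] [InnerProductSpace ℝ H] [CompleteSpace H] [RKHS ℝ H X ℝ]
    (hker : Measurable fun p : X × X => KernelSGD.ker H p.1 p.2)
    (φ : ℝ → ℝ) (hφ_nonneg : ∀ v, 0 ≤ φ v) (M L R δ : ℝ)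
    -- (A1)
    (hφ_diff : Differentiable ℝ φ) (hφ_conv : ConvexOn ℝ univ φ)
    (hM : 0 < M) (hφ_bdd : ∀ (ζ : ℝ) (y : ℤˣ), |KernelSGD.lossDeriv φ ζ y| ≤ M)
    (hL : 0 < L)
    (hL_smooth : ∀ g h : H,
      |KernelSGD.riskH φ ρ (g + h) - KernelSGD.riskH φ ρ g
        - ⟪gradient (KernelSGD.riskH φ ρ) g, h⟫_ℝ| ≤ L / 2 * ‖h‖ ^ 2)
    -- (A2)
    (hsupp : ρ.fst.support = univ)
    (hR : 0 < R) (hker_bdd : ∀ x : X, KernelSGD.ker H x x ≤ R ^ 2)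
    -- (A3)
    (hδ : δ ∈ Ioo (0 : ℝ) (1 / 2))
    (hnoise : ∀ᵐ x ∂ρ.fst, δ < |KernelSGD.condProb ρ x - 1 / 2|)
    -- (A4)
    (hprob : ∀ᵐ x ∂ρ.fst, KernelSGD.condProb ρ x ∈ Ioo (0 : ℝ) 1)
    (hlink : KernelSGD.LinkWellDefined φ)
    (hlink_diff : DifferentiableOn ℝ (KernelSGD.link φ) (Ioo 0 1))
    (hlink_mono : MonotoneOn (KernelSGD.link φ) (Ioo 0 1))
    (hlink_inj : InjOn (KernelSGD.link φ) (Ioo 0 1))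
    (hlink_sign : ∀ μ ∈ Ioo (0 : ℝ) 1,
      Real.sign (μ - 1 / 2) = Real.sign (KernelSGD.link φ μ))
    -- (A5)
    (hbreg : ∀ η₁ ∈ Ioo (0 : ℝ) 1, ∀ η₂ ∈ Ioo (0 : ℝ) 1,
      KernelSGD.bregman φ η₁ η₂ = 0 ↔ η₁ = η₂)
    (hbayes : ∃ gs : H, KernelSGD.IsBayesRule φ ρ gs ∧
      ∀ f : X → ℝ, KernelSGD.IsBayesRule φ ρ f → f =ᵐ[ρ.fst] gs) :
    ∃ lam₀ : ℝ, 0 < lam₀ ∧ ∀ lam : ℝ, 0 < lam → lam ≤ lam₀ →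
      -- the minimizer `g_λ` of the regularized risk
      ∃ gl : H, (∀ g : H, KernelSGD.regRisk φ ρ lam gl ≤ KernelSGD.regRisk φ ρ lam g) ∧
      ∀ (γ σ : ℝ) (g₁ : H), 0 < γ →
        KernelSGD.stepSize lam γ 1 ≤ min (1 / (L + lam)) (1 / (2 * lam)) →
        0 < σ → (∀ g : H, KernelSGD.gradVariance φ ρ g ≤ σ ^ 2) →
        ‖g₁‖ ≤ (2 * KernelSGD.stepSize lam γ 1 + 1 / lam) * M * R →
      ∀ (Ω : Type*) [MeasurableSpace Ω] (P : Measure Ω) [IsProbabilityMeasure P]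
        (Z : ℕ → Ω → X × ℤˣ), (∀ t, HasLaw (Z t) ρ P) → iIndepFun Z P →
      ∀ T : ℕ,
        32 * R ^ 2 * KernelSGD.nu φ ρ lam γ L σ g₁ gl / (KernelSGD.margin φ δ ^ 2 * lam) - γ ≤ T →
        Integrable (fun ω => KernelSGD.classError ρ
            (KernelSGD.sgd φ lam γ g₁ (fun t => Z t ω) T : H)) P ∧
        ∫ ω, (KernelSGD.classError ρ (KernelSGD.sgd φ lam γ g₁ (fun t => Z t ω) T : H)
            - KernelSGD.classError ρ (KernelSGD.bayesClassifier ρ)) ∂P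
          ≤ 2 * Real.exp (-(KernelSGD.margin φ δ ^ 2 * lam ^ 2 * (γ + T)
              / (2 ^ 9 * 9 * M ^ 2 * R ^ 4))) := by
  have hP : KernelSGD.SmoothProblem H φ ρ M L R :=
    ⟨hker, hφ_nonneg, hφ_diff, hφ_conv, hM, hφ_bdd, hL, hL_smooth, hR, hker_bdd⟩
  obtain ⟨gs, hgs, huniq⟩ := hbayes
  choose! gl hgl using fun (lam : ℝ) (hlam : 0 < lam) =>
    KernelSGD.exists_regularized_critical_point hL hlam hP.gradient_tangent_le hP.gradient_smooth
  obtain ⟨g₀, hlim, hle⟩ := KernelSGD.exists_tendsto_regularized hP.gradient_tangent_le hgl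
    fun g => hgs.2.2 g (hP.measurable_coe g) (hP.integrable_loss g)
  have hg₀ : KernelSGD.IsBayesRule φ ρ g₀ :=
    ⟨hP.measurable_coe g₀, hP.integrable_loss g₀, fun f hf hfin => hle.trans (hgs.2.2 f hf hfin)⟩
  have hg₀link := KernelSGD.ae_eq_link_of_isBayesRule hφ_diff hφ_nonneg hlink hlink_diff hprob hg₀
    fun f hf => (huniq f hf).trans (huniq g₀ hg₀).symm
  have hm : 0 < KernelSGD.margin φ δ := by
    rw [KernelSGD.margin_eq hlink hδ hlink_sign]
    exact KernelSGD.link_half_add_pos hδ hlink_sign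
  -- Half of the radius `m(δ)/R` goes to the regularization bias `gl lam - g₀`, the other half to
  -- the deviation of the iterate from `gl lam`.
  have hnear := hlim.eventually (Metric.ball_mem_nhds g₀
    (by positivity : 0 < KernelSGD.margin φ δ / (2 * R)))
  obtain ⟨lam₀, hlam₀, hsub⟩ := mem_nhdsGT_iff_exists_Ioc_subset.1 hnear
  refine ⟨lam₀, hlam₀, fun lam hlam hlamle => ⟨gl lam, fun g => ?_, ?_⟩⟩
  · have := KernelSGD.regularized_quadratic_growth hP.gradient_tangent_le (hgl lam hlam) g
    have h0 : 0 ≤ lam / 2 * ‖g - gl lam‖ ^ 2 := by positivity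
    rw [KernelSGD.regRisk, KernelSGD.regRisk]
    linarith
  intro γ σ g₁ hγ hη _ _ _ Ω _ P _ Z hlaw hind T hT
  have hclass : ∀ g : H, ‖g - gl lam‖ < KernelSGD.margin φ δ / (2 * R) →
      KernelSGD.classError ρ g = KernelSGD.classError ρ (KernelSGD.bayesClassifier ρ) := by
    intro g hg
    refine KernelSGD.classError_congr ?_
    filter_upwards [hg₀link, hprob, hnoise] with x hx hx01 hxδ
    refine KernelSGD.sign_eq_of_abs_sub_link_lt hlink hδ hlink_mono hlink_sign hx01 hxδ ?_
    have hball : ‖gl lam - g₀‖ < KernelSGD.margin φ δ / (2 * R) := by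
      rw [← dist_eq_norm]
      exact hsub ⟨hlam, hlamle⟩
    have hnorm : ‖g - g₀‖ < KernelSGD.margin φ δ / R := by
      calc ‖g - g₀‖ ≤ ‖g - gl lam‖ + ‖gl lam - g₀‖ := norm_sub_le_norm_sub_add_norm_sub _ _ _
        _ < KernelSGD.margin φ δ / (2 * R) + KernelSGD.margin φ δ / (2 * R) := add_lt_add hg hball
        _ = KernelSGD.margin φ δ / R := by field_simp; norm_num
    rw [← hx]
    have habs := KernelSGD.abs_apply_le hR.le hker_bdd (g - g₀) x
    rw [RKHS.coe_sub, Pi.sub_apply] at habs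
    refine habs.trans_lt ?_
    rwa [lt_div_iff₀' hR] at hnorm
  -- `HasLaw` gives only almost everywhere measurability, so the samples are replaced by measurable
  -- versions.
  have hZae : ∀ t, (hlaw t).aemeasurable.mk (Z t) =ᵐ[P] Z t := fun t =>
    (hlaw t).aemeasurable.ae_eq_mk.symm
  have hsgd : ∀ᵐ ω ∂P, KernelSGD.sgd φ lam γ g₁ (fun t => Z t ω) T
      = KernelSGD.sgd φ lam γ g₁ (fun t => (hlaw t).aemeasurable.mk (Z t) ω) T := by
    filter_upwards [ae_all_iff.2 hZae] with ω hω
    simp only [hω]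
  obtain ⟨hint, hbound⟩ := hP.integral_classError_sgd_le hlam hγ hη (hgl lam hlam) hm hclass g₁
    (fun t => (hlaw t).aemeasurable.measurable_mk)
    (fun t => ((hlaw t).congr (hZae t)).map_eq) (hind.congr fun t => (hZae t).symm) T
    (hP.initial_error_le hlam hγ hm T.cast_nonneg (hgl lam hlam) hT)
  refine ⟨hint.congr (hsgd.mono fun ω hω => by simp only [hω]), ?_⟩
  refine (integral_congr_ae (hsgd.mono fun ω hω => ?_)).trans_le (hbound.trans ?_)
  · simp only [hω]
  have hexp : KernelSGD.margin φ δ ^ 2 * lam ^ 2 * (γ + T) / (2 ^ 9 * 9 * M ^ 2 * R ^ 4)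
      ≤ KernelSGD.margin φ δ ^ 2 * lam ^ 2 * (γ + T) / (2 ^ 9 * M ^ 2 * R ^ 4) := by
    gcongr
    norm_num
  gcongr
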